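/- Let $n\ge 1$ and $1\le k<n$, let $\sigma\in\mathfrak S_n$, and let $\omega=n\cdots 21$ be the maximal permutation. Let $\zeta$ be the element of maximal length of the coset $\sigma(\mathfrak S_k\times\mathfrak S_{n-k})$. Here $\sigma\mu=\sigma\circ\mu$, $s_i=(i,i+1)$ is a simple transposition, and $\ell$ denotes the length, i.e. the number of letters of a reduced (shortest) decomposition into simple transpositions. On the free module (over any commutative ring) with basis $(K_\mu)_{\mu\in\mathfrak S_n}$ let $\pi_i$ ($1\le i<n$) be the linear operator, acting on the right, with $K_\mu\pi_i=K_{\mu s_i}$ if $\mu(i)>\mu(i+1)$ and $K_\mu\pi_i=K_\mu$ otherwise, and let $\hat\pi_i=\pi_i-1$. For a reduced decomposition $w=s_{i_1}\cdots s_{i_r}$ put $\pi_w=\pi_{i_1}\cdots\pi_{i_r}$ and $\hat\pi_w=\hat\pi_{i_1}\cdots\hat\pi_{i_r}$. A transposition $\tau$ is a Bruhat transposition for $\mu$ if $\ell(\mu\tau)=\ell(\mu)+1$. Put $K_\mu\cdot\tau=K_{\mu\tau}$ if $\tau$ is a Bruhat transposition for $\mu$, and $K_\mu\cdot\tau=0$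 otherwise, extended linearly. Let $W_{\sigma,k}=(\tau_1\prec\tau_2\prec\dots\prec\tau_m)$ be the list of all Bruhat transpositions $(a,b)$ for $\sigma$ with $a\le k<b$, totally ordered by $$(a,b)\prec(a',b')\iff \sigma(a)>\sigma(a')\ \text{ or }\ \bigl(a=a'\text{ and }\sigma(b)<\sigma(b')\bigr).$$ Then, whatever reduced decompositions of $\omega\zeta$ and $\zeta^{-1}\sigma$ are used, $$K_\omega\,\hat\pi_{\omega\zeta}\,\pi_{\zeta^{-1}\sigma}=\mathfrak E_{\sigma,k},\qquad \mathfrak E_{\sigma,k}:=K_\sigma\cdot(1-\tau_1)\cdot(1-\tau_2)\cdots(1-\tau_m).$$ Call a subword $w=\tau_{j_1}\cdots\tau_{j_r}$ ($j_1<\dots<j_r$) of $W_{\sigma,k}$ valid if $\tau_{j_i}$ is a Bruhat transposition for $\sigma\tau_{j_1}\cdots\tau_{j_{i-1}}$ for every $1\le i\le r$, and write $\sigma w=\sigma\tau_{j_1}\cdots\tau_{j_r}$ and $|w|=r$. Then $$\mathfrak E_{\sigma,k}=\sum_{w\text{ valid}}(-1)^{|w|}K_{\sigma w},$$ and there is no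 cancellation in this sum: distinct valid subwords $w$ give distinct permutations $\sigma w$. Thus the coefficient of $K_\mu$ in $\mathfrak E_{\sigma,k}$ is $(-1)^{\ell(\mu)-\ell(\sigma)}=\pm1$ if $\mu=\sigma w$ for some valid subword $w$ (and then $\ell(\mu)\ge\ell(\sigma)$), and $0$ otherwise. -/

import Mathlib

namespace ZeroHecke

/-! ### The symmetric group

Permutations of `{1, …, n}` are elements of `Equiv.Perm (Fin n)` (positions and values are shifted
by one), with `(σ * μ) i = σ (μ i)`; multiplying on the right by `Equiv.swap a b` exchanges the
letters in positions `a` and `b`. -/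

/-- The simple transposition exchanging the consecutive (zero-based) positions `i` and `i + 1`. -/
def simple {n : ℕ} (i : Fin (n - 1)) : Equiv.Perm (Fin n) :=
  Equiv.swap ⟨i.val, by omega⟩ ⟨i.val + 1, by omega⟩

/-- The permutation `s_{i₁} ⋯ s_{iᵣ}` written by a word in the simple transpositions. -/
def wordProd {n : ℕ} (u : List (Fin (n - 1))) : Equiv.Perm (Fin n) :=
  (u.map simple).prod

/-- The length of a permutation: the least number of letters of a decomposition of it into simple
transpositions. -/
noncomputable def len {n : ℕ} (w : Equiv.Perm (Fin n)) : ℕ :=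
  sInf {m : ℕ | ∃ u : List (Fin (n - 1)), u.length = m ∧ wordProd u = w}

/-- `u` is a reduced decomposition of `w`. -/
def IsReducedWord {n : ℕ} (u : List (Fin (n - 1))) (w : Equiv.Perm (Fin n)) : Prop :=
  wordProd u = w ∧ u.length = len w

theorem exists_wordProd {n : ℕ} (w : Equiv.Perm (Fin n)) :
    ∃ u : List (Fin (n - 1)), wordProd u = w := by
  cases n with
  | zero => exact ⟨[], Subsingleton.elim _ _⟩
  | succ m =>
    have h : w ∈ Submonoid.closure
        (Set.range fun i : Fin m => Equiv.swap i.castSucc i.succ) := by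
      rw [Equiv.Perm.mclosure_swap_castSucc_succ]; trivial
    induction h using Submonoid.closure_induction with
    | mem x hx =>
      obtain ⟨i, rfl⟩ := hx
      exact ⟨[i], by simp only [wordProd, List.map_cons, List.map_nil, List.prod_singleton]; rfl⟩
    | one => exact ⟨[], rfl⟩
    | mul x y _ _ hx hy =>
      obtain ⟨u, rfl⟩ := hx
      obtain ⟨v, rfl⟩ := hy
      exact ⟨u ++ v, by simp [wordProd]⟩

/-- Every permutation has a reduced decomposition. -/
theorem exists_isReducedWord {n : ℕ} (w : Equiv.Perm (Fin n)) :
    ∃ u : List (Fin (n - 1)), IsReducedWord u w := by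
  obtain ⟨u, hu⟩ := exists_wordProd w
  have hne : {m : ℕ | ∃ u : List (Fin (n - 1)), u.length = m ∧ wordProd u = w}.Nonempty :=
    ⟨u.length, u, rfl, hu⟩
  obtain ⟨v, hv, hw⟩ := Nat.sInf_mem hne
  exact ⟨v, hw, hv⟩

/-- The maximal permutation `ω = n ⋯ 2 1`. -/
def omega (n : ℕ) : Equiv.Perm (Fin n) := Fin.revPerm

/-- `μ` lies in the coset `σ (𝔖_k × 𝔖_{n-k})`, where `𝔖_k × 𝔖_{n-k}` consists of the permutations
that preserve the set of the first `k` positions. -/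
def InCoset {n : ℕ} (k : ℕ) (σ μ : Equiv.Perm (Fin n)) : Prop :=
  ∃ g : Equiv.Perm (Fin n), (∀ i, (g i).val < k ↔ i.val < k) ∧ μ = σ * g

/-- `ζ` is the maximal element (the element of maximal length) of `σ (𝔖_k × 𝔖_{n-k})`. -/
def IsMaxInCoset {n : ℕ} (k : ℕ) (σ ζ : Equiv.Perm (Fin n)) : Prop :=
  InCoset k σ ζ ∧ ∀ μ, InCoset k σ μ → len μ ≤ len ζ

theorem exists_isMaxInCoset {n : ℕ} (k : ℕ) (σ : Equiv.Perm (Fin n)) :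
    ∃ ζ, IsMaxInCoset k σ ζ := by
  obtain ⟨ζ, h, h'⟩ := Set.exists_max_image {μ | InCoset k σ μ} len (Set.toFinite _)
    ⟨σ, 1, by simp, by simp⟩
  exact ⟨ζ, h, h'⟩

/-! ### Bruhat transpositions

A transposition `(a, b)` is represented by the pair of positions it exchanges. -/

/-- The product `μ τ`. -/
def mulT {n : ℕ} (μ : Equiv.Perm (Fin n)) (τ : Fin n × Fin n) : Equiv.Perm (Fin n) :=
  μ * Equiv.swap τ.1 τ.2

/-- `τ` is a Bruhat transposition for `μ`: `μ τ` covers `μ` in the Bruhat order. -/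
def IsBruhat {n : ℕ} (μ : Equiv.Perm (Fin n)) (τ : Fin n × Fin n) : Prop :=
  len (mulT μ τ) = len μ + 1

/-- `τ = (a, b)` is a `k`-transposition, `a ≤ k < b` for one-based positions, and it is a Bruhat
transposition for `σ`. -/
def IsKBruhat {n : ℕ} (k : ℕ) (σ : Equiv.Perm (Fin n)) (τ : Fin n × Fin n) : Prop :=
  τ.1.val < k ∧ k ≤ τ.2.val ∧ IsBruhat σ τ

/-- The reflexive form of the total order `≺` on transpositions attached to `σ`:
`(a, b) ≺ (a', b')` iff `σ a > σ a'`, or `a = a'` and `σ b < σ b'`. -/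
def Prec {n : ℕ} (σ : Equiv.Perm (Fin n)) (τ θ : Fin n × Fin n) : Prop :=
  σ θ.1 < σ τ.1 ∨ (τ.1 = θ.1 ∧ σ τ.2 ≤ σ θ.2)

instance {n : ℕ} (σ : Equiv.Perm (Fin n)) : DecidableRel (Prec σ) :=
  fun _ _ => inferInstanceAs (Decidable (_ ∨ _))

instance {n : ℕ} (σ : Equiv.Perm (Fin n)) : IsTrans (Fin n × Fin n) (Prec σ) where
  trans := by
    rintro ⟨a, b⟩ ⟨c, d⟩ ⟨e, f⟩ (h | ⟨h, h'⟩) (g | ⟨g, g'⟩)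
    · exact Or.inl (lt_trans g h)
    · simp only at g h; exact Or.inl (g ▸ h)
    · simp only at g h; exact Or.inl (h ▸ g)
    · exact Or.inr ⟨h.trans g, le_trans h' g'⟩

instance {n : ℕ} (σ : Equiv.Perm (Fin n)) : Std.Antisymm (Prec σ) where
  antisymm := by
    rintro ⟨a, b⟩ ⟨c, d⟩ (h | ⟨h, h'⟩) (g | ⟨g, g'⟩)
    · exact absurd h (lt_asymm g)
    · simp only at g h; subst g; exact absurd h (lt_irrefl _)
    · simp only at g h; subst h; exact absurd g (lt_irrefl _)
    · simp only at h h' g'; rw [h, σ.injective (le_antisymm h' g')]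

instance {n : ℕ} (σ : Equiv.Perm (Fin n)) : Std.Total (Prec σ) where
  total := by
    rintro ⟨a, b⟩ ⟨c, d⟩
    rcases lt_trichotomy (σ a) (σ c) with h | h | h
    · exact Or.inr (Or.inl h)
    · have h := σ.injective h
      rcases le_total (σ b) (σ d) with g | g
      · exact Or.inl (Or.inr ⟨h, g⟩)
      · exact Or.inr (Or.inr ⟨h.symm, g⟩)
    · exact Or.inl (Or.inl h)

open Classical in
/-- `W_{σ,k}`: the list of the `k`-transpositions that are Bruhat transpositions for `σ`, in
increasing order for `≺`. -/
noncomputable def W {n : ℕ} (k : ℕ) (σ : Equiv.Perm (Fin n)) : List (Fin n × Fin n) :=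
  (Finset.univ.filter (IsKBruhat k σ)).sort (Prec σ)

/-- The word `w` of transpositions is valid from `μ`: applying its letters successively on the right
of `μ` goes up by one cover of the Bruhat order at each step. -/
def IsValid {n : ℕ} : Equiv.Perm (Fin n) → List (Fin n × Fin n) → Prop
  | _, [] => True
  | μ, τ :: w => IsBruhat μ τ ∧ IsValid (mulT μ τ) w

/-- `μ w`, the permutation reached from `μ` by applying the letters of `w` successively. -/
def endpoint {n : ℕ} (μ : Equiv.Perm (Fin n)) (w : List (Fin n × Fin n)) : Equiv.Perm (Fin n) :=
  w.foldl mulT μ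

open Classical in
/-- The finite set of the subwords of `W_{σ,k}` that are valid from `σ`. -/
noncomputable def validSubwords {n : ℕ} (k : ℕ) (σ : Equiv.Perm (Fin n)) :
    Finset (List (Fin n × Fin n)) :=
  (W k σ).sublists.toFinset.filter (IsValid σ)

/-! ### Operators on the free module with basis `K`

All operators act on the right of vectors: `f.foldl` applies the letters of a word from left to
right. -/

/-- The basis vector `K_σ`. -/
noncomputable def K (R : Type*) [CommRing R] {n : ℕ} (σ : Equiv.Perm (Fin n)) :
    Equiv.Perm (Fin n) →₀ R :=
  Finsupp.single σ 1

/-- `K_σ π_i = K_{σ s_i}` if `σ_i > σ_{i+1}`, and `K_σ π_i = K_σ` otherwise. -/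
noncomputable def pi (R : Type*) [CommRing R] {n : ℕ} (i : Fin (n - 1)) :
    (Equiv.Perm (Fin n) →₀ R) →ₗ[R] (Equiv.Perm (Fin n) →₀ R) :=
  Finsupp.linearCombination R fun σ : Equiv.Perm (Fin n) =>
    if σ ⟨i.val + 1, by omega⟩ < σ ⟨i.val, by omega⟩ then K R (σ * simple i) else K R σ

/-- `π̂_i = π_i - 1`. -/
noncomputable def piHat (R : Type*) [CommRing R] {n : ℕ} (i : Fin (n - 1)) :
    (Equiv.Perm (Fin n) →₀ R) →ₗ[R] (Equiv.Perm (Fin n) →₀ R) :=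
  pi R i - LinearMap.id

/-- `x π_{i₁} ⋯ π_{iᵣ}`; this is `x π_w` when `i₁ ⋯ iᵣ` is a reduced decomposition of `w`. -/
noncomputable def piWord {R : Type*} [CommRing R] {n : ℕ} (x : Equiv.Perm (Fin n) →₀ R)
    (u : List (Fin (n - 1))) : Equiv.Perm (Fin n) →₀ R :=
  u.foldl (fun y i => pi R i y) x

/-- `x π̂_{i₁} ⋯ π̂_{iᵣ}`; this is `x π̂_w` when `i₁ ⋯ iᵣ` is a reduced decomposition of `w`. -/
noncomputable def piHatWord {R : Type*} [CommRing R] {n : ℕ} (x : Equiv.Perm (Fin n) →₀ R)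
    (u : List (Fin (n - 1))) : Equiv.Perm (Fin n) →₀ R :=
  u.foldl (fun y i => piHat R i y) x

open Classical in
/-- `K_μ · τ = K_{μ τ}` if `τ` is a Bruhat transposition for `μ`, and `K_μ · τ = 0` otherwise. -/
noncomputable def actT (R : Type*) [CommRing R] {n : ℕ} (τ : Fin n × Fin n) :
    (Equiv.Perm (Fin n) →₀ R) →ₗ[R] (Equiv.Perm (Fin n) →₀ R) :=
  Finsupp.linearCombination R fun μ : Equiv.Perm (Fin n) =>
    if IsBruhat μ τ then K R (mulT μ τ) else 0

/-- `K_σ · (1 - τ₁) · (1 - τ₂) ⋯ (1 - τₘ)` where `W_{σ,k} = (τ₁ ≺ τ₂ ≺ ⋯ ≺ τₘ)`. -/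
noncomputable def E (R : Type*) [CommRing R] {n : ℕ} (k : ℕ) (σ : Equiv.Perm (Fin n)) :
    Equiv.Perm (Fin n) →₀ R :=
  (W k σ).foldl (fun x τ => x - actT R τ x) (K R σ)

end ZeroHecke

open ZeroHecke

/-! Length is the number of inversions, so a Bruhat transposition `(a, b)` of `μ` is an empty
rectangle between two points of the graph of `μ` (`isBruhat_iff`). The operators `1 - (a, b)`
commute on disjoint positions and satisfy the Yang–Baxter equation (`rop_yangBaxter`).

Let A be their product over all transpositions, column by column (`ascCols`). No transposition goes
up from ω, so K_ω = K_ω A. The relation `ascCols_mul_piHat` moves π̂_i to the left of A, where it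
becomes an operator that sends K_μ to K_{μ s_i} at a descent. The word of ωζ then descends from ω to
ζ, and K_ω π̂_{ωζ} = K_ζ A. Since ζ decreases on both blocks, the factors internal to a block act
trivially once Yang–Baxter has brought them to the front (`app_ascCols_eq`). What remains is a
product D of `k`-transpositions (`descCols`). D commutes with π_i for i ≠ k (`descCols_commute_pi`),
so π_{ζ⁻¹σ} takes K_ζ D to K_σ D. In K_σ D the letters that are not covers of σ drop out, and the
others can be rearranged into the order ≺, because two covers on which the orders disagree are
disjoint (`app_descCols_eq_E`).

Expanding the product gives the sum over valid subwords. If two of them had equal endpoints but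
different last letters, the ≺-larger one `τ = (a, b)` would force values at `a` and `b` that letters
preceding τ cannot produce (`not_endpoint_apply_lt`). So the last letters agree, and induction gives
uniqueness. -/

namespace ZeroHecke
open Equiv

/-! ### Length and inversions -/

/-- The inversions of a permutation. -/
def invSet {n : ℕ} (μ : Perm (Fin n)) : Finset (Fin n × Fin n) :=
  Finset.univ.filter fun p => p.1 < p.2 ∧ μ p.2 < μ p.1

/-- The number of inversions of a permutation. -/
def inv {n : ℕ} (μ : Perm (Fin n)) : ℕ := (invSet μ).card

theorem mem_invSet {n : ℕ} {μ : Perm (Fin n)} {x y : Fin n} :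
    (x, y) ∈ invSet μ ↔ x < y ∧ μ y < μ x := by
  rw [invSet, Finset.mem_filter]; simp

/-- Applying the swap to both entries of a pair carries the inversions of the product to those of
`μ`. Only the pair `(p, q)` has its positions reversed, and it accounts for the extra element. -/
theorem inv_mul_swap_of_lt {n : ℕ} (μ : Perm (Fin n)) {p q : Fin n} (hpq : q.val = p.val + 1)
    (h : μ p < μ q) : inv (μ * swap p q) = inv μ + 1 := by
  have hne : p ≠ q := fun e => by simp [e] at hpq
  have key : (invSet (μ * swap p q)).map
      ((swap p q).prodCongr (swap p q)).toEmbedding = insert (q, p) (invSet μ) := by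
    ext ⟨x, y⟩
    rw [Finset.mem_map_equiv, Finset.mem_insert, mem_invSet, prodCongr_symm, symm_swap,
      prodCongr_apply, Prod.map, mem_invSet, Prod.mk.injEq, Perm.mul_apply, Perm.mul_apply,
      swap_apply_self, swap_apply_self, swap_apply_def, swap_apply_def]
    grind
  have hnot : (q, p) ∉ invSet μ := by
    rw [mem_invSet, Fin.lt_def]; omega
  have := congrArg Finset.card key
  rwa [Finset.card_map, Finset.card_insert_of_notMem hnot] at this

theorem inv_mul_swap_of_gt {n : ℕ} (μ : Perm (Fin n)) {p q : Fin n} (hpq : q.val = p.val + 1)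
    (h : μ q < μ p) : inv (μ * swap p q) + 1 = inv μ := by
  have := inv_mul_swap_of_lt (μ * swap p q) hpq (by simpa using h)
  rw [← this]; simp [mul_assoc]

/-- Left end of the simple transposition `i`. -/
def lft {n : ℕ} (i : Fin (n - 1)) : Fin n := ⟨i.val, by omega⟩

/-- Right end of the simple transposition `i`. -/
def rgt {n : ℕ} (i : Fin (n - 1)) : Fin n := ⟨i.val + 1, by omega⟩

theorem simple_eq {n : ℕ} (i : Fin (n - 1)) : simple i = swap (lft i) (rgt i) := rfl

theorem rgt_val {n : ℕ} (i : Fin (n - 1)) : (rgt i).val = (lft i).val + 1 := rfl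

theorem lft_val {n : ℕ} (i : Fin (n - 1)) : (lft i).val = i.val := rfl

theorem lft_ne_rgt {n : ℕ} (i : Fin (n - 1)) : lft i ≠ rgt i := by
  simp [Fin.ext_iff, rgt_val]

theorem inv_mul_simple_of_lt {n : ℕ} (μ : Perm (Fin n)) {i : Fin (n - 1)}
    (h : μ (lft i) < μ (rgt i)) : inv (μ * simple i) = inv μ + 1 :=
  inv_mul_swap_of_lt μ (rgt_val i) h

theorem inv_mul_simple_of_gt {n : ℕ} (μ : Perm (Fin n)) {i : Fin (n - 1)}
    (h : μ (rgt i) < μ (lft i)) : inv (μ * simple i) + 1 = inv μ :=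
  inv_mul_swap_of_gt μ (rgt_val i) h

theorem lt_or_gt_simple {n : ℕ} (μ : Perm (Fin n)) (i : Fin (n - 1)) :
    μ (lft i) < μ (rgt i) ∨ μ (rgt i) < μ (lft i) :=
  lt_or_gt_of_ne (μ.injective.ne (lft_ne_rgt i))

theorem inv_one {n : ℕ} : inv (1 : Perm (Fin n)) = 0 := by
  rw [inv, Finset.card_eq_zero, Finset.eq_empty_iff_forall_notMem]
  rintro ⟨x, y⟩ h
  rw [mem_invSet] at h
  exact lt_asymm h.1 h.2

theorem wordProd_append_singleton {n : ℕ} (u : List (Fin (n - 1))) (i : Fin (n - 1)) :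
    wordProd (u ++ [i]) = wordProd u * simple i := by
  simp [wordProd]

theorem inv_wordProd_le {n : ℕ} (u : List (Fin (n - 1))) : inv (wordProd u) ≤ u.length := by
  induction u using List.reverseRecOn with
  | nil => simp [wordProd, inv_one]
  | append_singleton u i ih =>
    rw [wordProd_append_singleton, List.length_append, List.length_singleton]
    rcases lt_or_gt_simple (wordProd u) i with h | h
    · rw [inv_mul_simple_of_lt _ h]; omega
    · have := inv_mul_simple_of_gt _ h; omega

theorem eq_one_of_forall_lt {n : ℕ} (μ : Perm (Fin n))
    (h : ∀ i : Fin (n - 1), μ (lft i) < μ (rgt i)) : μ = 1 := by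
  have hm : StrictMono μ := by
    cases n with
    | zero => intro a; exact a.elim0
    | succ m => exact Fin.strictMono_iff_lt_succ.2 fun i => h i
  ext i
  have : (⇑μ : Fin n → Fin n) = id :=
    (StrictMono.range_inj hm strictMono_id).1 (by simp [μ.surjective.range_eq])
  simp [this]

/-- Bubble sort: each descent removed costs one letter and one inversion. -/
theorem exists_wordProd_length_inv {n : ℕ} (μ : Perm (Fin n)) :
    ∃ u : List (Fin (n - 1)), u.length = inv μ ∧ wordProd u = μ := by
  induction hm : inv μ using Nat.strong_induction_on generalizing μ with
  | _ m ih =>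
    by_cases h : ∀ i : Fin (n - 1), μ (lft i) < μ (rgt i)
    · have := eq_one_of_forall_lt μ h
      subst this
      rw [inv_one] at hm
      exact ⟨[], by simp [hm], rfl⟩
    · push Not at h
      obtain ⟨i, hi⟩ := h
      have hi := lt_of_le_of_ne hi (μ.injective.ne (lft_ne_rgt i).symm)
      have e := inv_mul_simple_of_gt _ hi
      obtain ⟨u, hu, hu'⟩ := ih _ (by omega) (μ * simple i) rfl
      refine ⟨u ++ [i], by simp; omega, ?_⟩
      rw [wordProd_append_singleton, hu', mul_assoc, simple_eq, swap_mul_self, mul_one]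

theorem len_eq_inv {n : ℕ} (μ : Perm (Fin n)) : len μ = inv μ := by
  apply le_antisymm
  · exact Nat.sInf_le (exists_wordProd_length_inv μ)
  · obtain ⟨u, hu, hu'⟩ := exists_isReducedWord μ
    rw [← hu', ← hu]
    exact inv_wordProd_le u

/-! ### Covers of the Bruhat order -/

/-- The values at positions `a` and `b` increase and no position strictly between them carries a
value strictly between theirs. -/
def Cov {n : ℕ} (μ : Perm (Fin n)) (a b : Fin n) : Prop :=
  μ a < μ b ∧ ∀ r, a < r → r < b → μ a < μ r → μ r < μ b → False

/-- The positions strictly between `a` and `b` with value strictly between `μ a` and `μ b`. -/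
def between {n : ℕ} (μ : Perm (Fin n)) (a b : Fin n) : Finset (Fin n) :=
  Finset.univ.filter fun r => (a < r ∧ r < b) ∧ (μ a < μ r ∧ μ r < μ b)

/-- With `c = b - 1`, write `(a b) = (c b)(a c)(c b)`. The two outer simple swaps contribute `+1`
each exactly when `μ c` lies between `μ a` and `μ b`; otherwise their contributions cancel. -/
theorem inv_mul_swap {n : ℕ} (μ : Perm (Fin n)) (a b : Fin n) (hab : a < b) (h : μ a < μ b) :
    inv (μ * swap a b) = inv μ + 1 + 2 * (between μ a b).card := by
  obtain ⟨d, hd⟩ : ∃ d, b.val = a.val + 1 + d := ⟨b.val - (a.val + 1), by rw [Fin.lt_def] at hab; omega⟩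
  induction d generalizing μ b with
  | zero =>
    rw [inv_mul_swap_of_lt μ (by omega) h]
    have : between μ a b = ∅ := by
      ext r
      simp only [between, Finset.mem_filter, Finset.notMem_empty, iff_false, Fin.lt_def]
      omega
    simp [this]
  | succ d ih =>
    let c : Fin n := ⟨a.val + 1 + d, by omega⟩
    have hc : c.val = a.val + 1 + d := rfl
    have hbc : b.val = c.val + 1 := by omega
    have hac : a < c := by rw [Fin.lt_def]; omega
    have hcb : c < b := by rw [Fin.lt_def]; omega
    have e : swap a b = swap c b * swap a c * swap c b := by
      rw [swap_mul_swap_mul_swap hac.ne hab.ne, swap_comm]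
    have ha : swap c b a = a := swap_apply_of_ne_of_ne hac.ne hab.ne
    have h1 := ih (μ * swap c b) c hac (by simpa [ha] using h) hc
    have hb1 : between (μ * swap c b) a c = (between μ a b).erase c := by
      ext r
      simp only [between, Finset.mem_filter, Finset.mem_univ, true_and, Finset.mem_erase,
        Perm.mul_apply, ha, swap_apply_left]
      by_cases hr : r = c
      · simp [hr]
      by_cases hr' : r = b
      · simp [hr', hcb.le]
      rw [swap_apply_of_ne_of_ne hr hr']
      simp only [Fin.lt_def, ne_eq, Fin.ext_iff] at *
      omega
    rw [e, ← mul_assoc, ← mul_assoc]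
    set ν := μ * swap c b * swap a c with hν
    have hνc : ν c = μ a := by simp [hν, ha]
    have hνb : ν b = μ c := by
      simp [hν, swap_apply_of_ne_of_ne hab.ne' hcb.ne']
    have hca : μ a ≠ μ c := μ.injective.ne hac.ne
    have hcb' : μ c ≠ μ b := μ.injective.ne hcb.ne
    have hmem : c ∈ between μ a b ↔ μ a < μ c ∧ μ c < μ b := by simp [between, hac, hcb]
    rw [hb1] at h1
    rcases lt_or_gt_of_ne hca with h2 | h2
    · rw [inv_mul_swap_of_lt ν hbc (by rw [hνc, hνb]; exact h2), h1]
      rcases lt_or_gt_of_ne hcb' with h3 | h3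
      · have hm := hmem.2 ⟨h2, h3⟩
        have := Finset.card_erase_add_one hm
        rw [inv_mul_swap_of_lt μ hbc h3]; omega
      · have hm : c ∉ between μ a b := fun hm => lt_asymm h3 (hmem.1 hm).2
        rw [Finset.erase_eq_of_notMem hm]
        have := inv_mul_swap_of_gt μ hbc h3; omega
    · have h3 : μ c < μ b := h2.trans h
      have hm : c ∉ between μ a b := fun hm => lt_asymm h2 (hmem.1 hm).1
      have := inv_mul_swap_of_gt ν hbc (by rw [hνc, hνb]; exact h2)
      rw [Finset.erase_eq_of_notMem hm] at h1
      rw [inv_mul_swap_of_lt μ hbc h3] at h1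
      omega

theorem isBruhat_iff {n : ℕ} (μ : Perm (Fin n)) {a b : Fin n} (hab : a < b) :
    IsBruhat μ (a, b) ↔ Cov μ a b := by
  simp only [IsBruhat, mulT, len_eq_inv]
  rcases lt_or_gt_of_ne (μ.injective.ne hab.ne) with h | h
  · rw [inv_mul_swap μ a b hab h]
    have : (between μ a b).card = 0 ↔ Cov μ a b := by
      rw [Finset.card_eq_zero, Finset.eq_empty_iff_forall_notMem]
      simp only [between, Finset.mem_filter, Finset.mem_univ, true_and, Cov, h]
      exact forall_congr' fun r => by tauto
    rw [← this]; omega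
  · have := inv_mul_swap (μ * swap a b) a b hab (by simpa using h)
    rw [mul_assoc, swap_mul_self, mul_one] at this
    have h' : ¬ Cov μ a b := fun hc => lt_asymm h hc.1
    simp only [h', iff_false]; omega

/-! ### Reduced words in a maximal parabolic subgroup -/

/-- `μ` decreases on the first `k` positions and on the remaining ones. -/
def DecOnBlocks {n : ℕ} (k : ℕ) (μ : Perm (Fin n)) : Prop :=
  ∀ a b : Fin n, a < b → (a.val < k ↔ b.val < k) → μ b < μ a

/-- An ascent inside a block could be swapped without leaving the coset, and the length would grow.
-/
theorem decOnBlocks_of_isMaxInCoset {n k : ℕ} {σ ζ : Perm (Fin n)} (h : IsMaxInCoset k σ ζ) :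
    DecOnBlocks k ζ := by
  -- Positions are zero-based, so the simple transposition `i` straddles the two blocks exactly when
  -- `i + 1 = k`.
  have key : ∀ i : Fin (n - 1), i.val + 1 ≠ k → ζ (rgt i) < ζ (lft i) := by
    intro i hi
    by_contra hlt
    have hlt := (lt_or_gt_simple ζ i).resolve_right hlt
    have h1 := inv_mul_simple_of_lt ζ hlt
    obtain ⟨⟨g, hg, hζ⟩, hmax⟩ := h
    have := hmax (ζ * simple i) ⟨g * simple i, fun j => by
      rw [Perm.mul_apply, hg, simple_eq]
      by_cases h1 : j = lft i
      · subst h1; rw [swap_apply_left, rgt_val, lft_val]; omega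
      · by_cases h2 : j = rgt i
        · subst h2; rw [swap_apply_right, rgt_val, lft_val]; omega
        · rw [swap_apply_of_ne_of_ne h1 h2], by rw [hζ, mul_assoc]⟩
    rw [len_eq_inv, len_eq_inv] at this
    omega
  intro a b hab hk
  obtain ⟨d, hd⟩ : ∃ d, b.val = a.val + 1 + d :=
    ⟨b.val - (a.val + 1), by rw [Fin.lt_def] at hab; omega⟩
  induction d generalizing b with
  | zero =>
    have := key ⟨a.val, by omega⟩ (by simp only; omega)
    have e : b = rgt ⟨a.val, by omega⟩ := Fin.ext (by rw [hd]; rfl)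
    rw [e]; exact this
  | succ d ih =>
    have h1 := ih ⟨a.val + 1 + d, by omega⟩ (by rw [Fin.lt_def]; simp only; omega)
      (by simp only; omega) rfl
    have := key ⟨a.val + 1 + d, by omega⟩ (by simp only; omega)
    have e : b = rgt ⟨a.val + 1 + d, by omega⟩ := Fin.ext (by rw [hd]; rfl)
    rw [e]; exact this.trans h1

/-- With `k = 0` there is a single block, so results on blocks also apply to ω and arbitrary words.
-/
theorem decOnBlocks_omega (n : ℕ) : DecOnBlocks 0 (omega n) := by
  intro a b hab _
  simpa [omega] using hab

/-- Splitting off the last letter of a reduced word of an element of `𝔖_k × 𝔖_{n-k}`. -/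
theorem reducedWord_append_singleton {n k : ℕ} {g : Perm (Fin n)}
    (hg : ∀ j, (g j).val < k ↔ j.val < k) {u : List (Fin (n - 1))} {i : Fin (n - 1)}
    (hu : IsReducedWord (u ++ [i]) g) :
    IsReducedWord u (wordProd u) ∧ g = wordProd u * simple i ∧ i.val + 1 ≠ k ∧
      (∀ j, (wordProd u j).val < k ↔ j.val < k) ∧
      wordProd u (lft i) < wordProd u (rgt i) := by
  obtain ⟨h1, h2⟩ := hu
  rw [wordProd_append_singleton] at h1
  rw [len_eq_inv, List.length_append, List.length_singleton, ← h1] at h2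
  have h3 := inv_wordProd_le u
  have hlt : wordProd u (lft i) < wordProd u (rgt i) := by
    rcases lt_or_gt_simple (wordProd u) i with h | h
    · exact h
    · have := inv_mul_simple_of_gt _ h; omega
  have h4 := inv_mul_simple_of_lt _ hlt
  -- Otherwise `wordProd u` would send `rgt i` into the first block and `lft i` out of it, against
  -- the ascent `hlt`.
  have hik : i.val + 1 ≠ k := by
    intro hik
    have e1 := hg (lft i)
    have e2 := hg (rgt i)
    rw [← h1, Perm.mul_apply, simple_eq] at e1 e2
    rw [swap_apply_left, lft_val] at e1
    rw [swap_apply_right, rgt_val, lft_val] at e2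
    rw [Fin.lt_def] at hlt
    omega
  refine ⟨⟨rfl, by rw [len_eq_inv]; omega⟩, h1.symm, hik, fun j => ?_, hlt⟩
  have e := hg (simple i j)
  rw [← h1, Perm.mul_apply, simple_eq, swap_apply_self] at e
  rw [e]
  by_cases h1 : j = lft i
  · subst h1; rw [swap_apply_left, rgt_val, lft_val]; omega
  · by_cases h2 : j = rgt i
    · subst h2; rw [swap_apply_right, rgt_val, lft_val]; omega
    · rw [swap_apply_of_ne_of_ne h1 h2]

section Operators

variable (R : Type*) [CommRing R] {n : ℕ}

/-! ### Operators acting on the right -/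

/-- Linear operators on the free module, multiplied in the order in which they are applied. -/
abbrev Op (R : Type*) [CommRing R] (n : ℕ) := (Module.End R (Perm (Fin n) →₀ R))ᵐᵒᵖ

variable {R}

/-- The right action of an operator on a vector. -/
noncomputable def app (x : Perm (Fin n) →₀ R) (f : Op R n) : Perm (Fin n) →₀ R := f.unop x

@[simp] theorem app_mul (x : Perm (Fin n) →₀ R) (f g : Op R n) :
    app x (f * g) = app (app x f) g := rfl

@[simp] theorem app_one (x : Perm (Fin n) →₀ R) : app x (1 : Op R n) = x := rfl

@[simp] theorem app_sub (x y : Perm (Fin n) →₀ R) (f : Op R n) :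
    app (x - y) f = app x f - app y f := map_sub f.unop x y

@[simp] theorem app_add (x y : Perm (Fin n) →₀ R) (f : Op R n) :
    app (x + y) f = app x f + app y f := map_add f.unop x y

@[simp] theorem app_zero (f : Op R n) : app (0 : Perm (Fin n) →₀ R) f = 0 := map_zero f.unop

theorem op_ext {f g : Op R n} (h : ∀ μ, app (K R μ) f = app (K R μ) g) : f = g := by
  apply MulOpposite.unop_injective
  apply Finsupp.lhom_ext'
  intro μ
  apply LinearMap.ext_ring
  exact h μ

variable (R)

/-- The operator `1 - τ` of the transposition `(a, b)`. -/
noncomputable def rop (a b : Fin n) : Op R n := MulOpposite.op (LinearMap.id - actT R (a, b))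

/-- The operator sending `K_μ` to `K_{μ s_i} + c K_μ` at a descent and to `d K_μ` at an ascent. -/
noncomputable def qop (c d : R) (i : Fin (n - 1)) : Op R n :=
  MulOpposite.op (Finsupp.linearCombination R fun μ : Perm (Fin n) =>
    if μ (rgt i) < μ (lft i) then K R (μ * simple i) + c • K R μ else d • K R μ)

variable {R}

theorem app_qop_of_gt (c d : R) {i : Fin (n - 1)} {μ : Perm (Fin n)} (h : μ (rgt i) < μ (lft i)) :
    app (K R μ) (qop R c d i) = K R (μ * simple i) + c • K R μ := by
  simp [app, qop, K, h]

theorem app_qop_of_lt (c d : R) {i : Fin (n - 1)} {μ : Perm (Fin n)} (h : μ (lft i) < μ (rgt i)) :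
    app (K R μ) (qop R c d i) = d • K R μ := by
  simp [app, qop, K, h.le]

/-- The parameter `d = 1` gives π_i; `d = -1` gives the operator that π̂_i becomes on the other side
of `ascCols`. -/
theorem pi_eq (i : Fin (n - 1)) (x : Perm (Fin n) →₀ R) : pi R i x = app x (qop R 0 1 i) := by
  have : MulOpposite.op (pi R i) = qop R 0 1 i := by
    apply op_ext
    intro μ
    rcases lt_or_gt_simple μ i with h | h
    · rw [app_qop_of_lt _ _ h]
      simp only [app, pi, K, MulOpposite.unop_op, Finsupp.linearCombination_single]
      rw [if_neg (by exact lt_asymm h)]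
    · rw [app_qop_of_gt _ _ h]
      simp only [app, pi, K, MulOpposite.unop_op, Finsupp.linearCombination_single]
      rw [if_pos (by exact h)]; simp
  rw [← this]; rfl

theorem piHat_eq (i : Fin (n - 1)) (x : Perm (Fin n) →₀ R) :
    piHat R i x = app x (qop R 0 1 i - 1) := by
  rw [piHat, LinearMap.sub_apply, pi_eq]; rfl

open Classical in
theorem actT_K {a b : Fin n} (hab : a < b) (μ : Perm (Fin n)) :
    actT R (a, b) (K R μ) = if Cov μ a b then K R (μ * swap a b) else 0 := by
  simp only [actT, K, Finsupp.linearCombination_single, isBruhat_iff μ hab, mulT, one_smul]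

theorem app_rop_of_cov {a b : Fin n} (hab : a < b) {μ : Perm (Fin n)} (h : Cov μ a b) :
    app (K R μ) (rop R a b) = K R μ - K R (μ * swap a b) := by
  simp only [app, rop, MulOpposite.unop_op, LinearMap.sub_apply, actT_K hab, if_pos h]; rfl

theorem app_rop_of_not_cov {a b : Fin n} (hab : a < b) {μ : Perm (Fin n)} (h : ¬ Cov μ a b) :
    app (K R μ) (rop R a b) = K R μ := by
  simp only [app, rop, MulOpposite.unop_op, LinearMap.sub_apply, actT_K hab, if_neg h, sub_zero]; rfl

open Classical in
theorem app_rop {a b : Fin n} (hab : a < b) (μ : Perm (Fin n)) :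
    app (K R μ) (rop R a b) = K R μ - if Cov μ a b then K R (μ * swap a b) else 0 := by
  split_ifs with h
  · exact app_rop_of_cov hab h
  · rw [app_rop_of_not_cov hab h, sub_zero]

/-- A cover is an empty rectangle spanned by two points of the graph. If either conclusion failed, a
corner of one rectangle would lie inside the other before or after the first swap, against one of
the hypotheses. -/
theorem cov_swap_disjoint {a b c d : Fin n} (hab : a < b) (hcd : c < d) (hac : a ≠ c) (had : a ≠ d)
    (hbc : b ≠ c) (hbd : b ≠ d) (μ : Perm (Fin n)) (h1 : Cov μ a b)
    (h2 : Cov (μ * swap a b) c d) : Cov μ c d ∧ Cov (μ * swap c d) a b := by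
  simp only [Cov, Perm.mul_apply, swap_apply_def] at *
  have i1 := μ.injective.ne hac
  have i2 := μ.injective.ne had
  have i3 := μ.injective.ne hbc
  have i4 := μ.injective.ne hbd
  simp only [hac.symm, had.symm, hbc.symm, hbd.symm, if_false, hac, had, hbc, hbd] at *
  refine ⟨⟨h2.1, fun r hr hr' => ?_⟩, h1.1, fun r hr hr' => ?_⟩
  · have := h2.2 r hr hr'
    have e1 := h1.2 c
    have e2 := h1.2 d
    grind
  · have := h1.2 r hr hr'
    have e1 := h2.2 a
    have e2 := h2.2 b
    have e3 := h1.2 c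
    have e4 := h1.2 d
    grind

/-- Disjoint transpositions give commuting operators. -/
theorem rop_commute {a b c d : Fin n} (hab : a < b) (hcd : c < d) (hac : a ≠ c) (had : a ≠ d)
    (hbc : b ≠ c) (hbd : b ≠ d) : Commute (rop R a b) (rop R c d) := by
  classical
  apply op_ext
  intro μ
  have key : (Cov μ a b ∧ Cov (μ * swap a b) c d) ↔ (Cov μ c d ∧ Cov (μ * swap c d) a b) :=
    ⟨fun h => cov_swap_disjoint hab hcd hac had hbc hbd μ h.1 h.2,
      fun h => cov_swap_disjoint hcd hab hac.symm hbc.symm had.symm hbd.symm μ h.1 h.2⟩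
  have e : swap a b * swap c d = swap c d * swap a b :=
    (Perm.disjoint_swap_swap (by simp [*, hab.ne, hcd.ne])).commute
  rw [app_mul, app_mul, app_rop hab, app_rop hcd, app_sub, app_sub, app_rop hab, app_rop hcd]
  by_cases h1 : Cov μ a b <;> by_cases h2 : Cov μ c d <;> simp only [h1, h2, if_true, if_false,
    app_zero, sub_zero, app_rop hab, app_rop hcd]
  · by_cases h3 : Cov (μ * swap a b) c d
    · rw [if_pos h3, if_pos (key.1 ⟨h1, h3⟩).2, mul_assoc, mul_assoc, e]; abel
    · rw [if_neg h3, if_neg fun h4 => h3 (key.2 ⟨h2, h4⟩).2]; abel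
  · rw [if_neg fun h3 => h2 (key.1 ⟨h1, h3⟩).1]; abel
  · rw [if_neg fun h3 => h1 (key.2 ⟨h2, h3⟩).1]; abel

end Operators

/-! ### The Yang–Baxter equation -/

section YangBaxter

variable {R : Type*} [CommRing R] {n : ℕ}

variable (R) in
/-- The operator of the transposition `(a, b)`. -/
noncomputable def top (a b : Fin n) : Op R n := MulOpposite.op (actT R (a, b))

theorem rop_eq (a b : Fin n) : rop R a b = 1 - top R a b := rfl

open Classical in
theorem app_top {a b : Fin n} (hab : a < b) (μ : Perm (Fin n)) :
    app (K R μ) (top R a b) = if Cov μ a b then K R (μ * swap a b) else 0 := actT_K hab μ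

open Classical in
theorem app_top_top {a b c d : Fin n} (hab : a < b) (hcd : c < d) (μ : Perm (Fin n)) :
    app (app (K R μ) (top R a b)) (top R c d) =
      if Cov μ a b ∧ Cov (μ * swap a b) c d then K R (μ * (swap a b * swap c d)) else 0 := by
  rw [app_top hab]
  by_cases h : Cov μ a b
  · simp only [h, if_true, true_and, app_top hcd, mul_assoc]
  · simp only [h, if_false, false_and, app_zero]

theorem top_mul_self {a b : Fin n} (hab : a < b) : top R a b * top R a b = 0 := by
  apply op_ext
  intro μ
  rw [app_mul, app_top_top hab hab, if_neg]
  · rfl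
  · rintro ⟨h1, h2⟩
    have := h2.1
    simp at this
    exact lt_asymm this h1.1

theorem eq_or_apply_ne {n : ℕ} (μ : Perm (Fin n)) (a b : Fin n) : a = b ∨ μ a ≠ μ b := by
  by_cases h : a = b
  · exact Or.inl h
  · exact Or.inr (μ.injective.ne h)

/-- All three products are the same 3-cycle. Which of the two alternatives occurs is decided by
comparing `μ b` with `μ c`. -/
theorem cov_ab_bc {n : ℕ} {a b c : Fin n} (hab : a < b) (hbc : b < c)
    (μ : Perm (Fin n)) :
    (Cov μ a b ∧ Cov (μ * swap a b) b c) ↔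
    (Cov μ b c ∧ Cov (μ * swap b c) a c) ∨ (Cov μ a c ∧ Cov (μ * swap a c) a b) := by
  have i1 := μ.injective.ne hab.ne
  have i2 := μ.injective.ne hbc.ne
  have i3 := μ.injective.ne (hab.trans hbc).ne
  have hac := hab.trans hbc
  simp only [Cov, Perm.mul_apply, swap_apply_def]
  simp only [hab.ne, hab.ne', hbc.ne, hbc.ne', hac.ne, hac.ne', if_false, if_true]
  constructor
  · rintro ⟨⟨h1, h2⟩, h3, h4⟩
    rcases lt_or_gt_of_ne i2 with h | h
    · left
      refine ⟨⟨h, fun r hr hr' => ?_⟩, h1, fun r hr hr' => ?_⟩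
      · have := h2 r
        have := h4 r
        grind
      · have := eq_or_apply_ne μ r a
        have := h2 r
        have := h4 r
        grind
    · right
      refine ⟨⟨h3, fun r hr hr' => ?_⟩, h, fun r hr hr' => ?_⟩
      · have := h2 r
        have := h4 r
        grind
      · have := h2 r
        have := h4 r
        grind
  · rintro (⟨⟨h1, h2⟩, h3, h4⟩ | ⟨⟨h1, h2⟩, h3, h4⟩)
    · refine ⟨⟨h3, fun r hr hr' => ?_⟩, by order, fun r hr hr' => ?_⟩
      · have := h2 r
        have := h4 r
        grind
      · have := h2 r
        have := h4 r
        have := eq_or_apply_ne μ r b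
        grind
    · have := h2 b
      refine ⟨⟨by grind, fun r hr hr' => ?_⟩, by order, fun r hr hr' => ?_⟩
      · have := h2 r
        have := h4 r
        have := eq_or_apply_ne μ r c
        grind
      · have := h2 r
        have := h4 r
        grind

/-- The companion for the inverse 3-cycle; here the comparison of `μ a` with `μ b` decides. -/
theorem cov_bc_ab {n : ℕ} {a b c : Fin n} (hab : a < b) (hbc : b < c)
    (μ : Perm (Fin n)) :
    (Cov μ b c ∧ Cov (μ * swap b c) a b) ↔
    (Cov μ a b ∧ Cov (μ * swap a b) a c) ∨ (Cov μ a c ∧ Cov (μ * swap a c) b c) := by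
  have i1 := μ.injective.ne hab.ne
  have i2 := μ.injective.ne hbc.ne
  have i3 := μ.injective.ne (hab.trans hbc).ne
  have hac := hab.trans hbc
  simp only [Cov, Perm.mul_apply, swap_apply_def]
  simp only [hab.ne, hab.ne', hbc.ne, hbc.ne', hac.ne, hac.ne', if_false, if_true]
  constructor
  · rintro ⟨⟨h1, h2⟩, h3, h4⟩
    rcases lt_or_gt_of_ne i1 with h | h
    · left
      refine ⟨⟨h, fun r hr hr' => ?_⟩, h1, fun r hr hr' => ?_⟩ <;>
      · have := h2 r
        have := h4 r
        have := eq_or_apply_ne μ r a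
        have := eq_or_apply_ne μ r b
        have := eq_or_apply_ne μ r c
        grind
    · right
      refine ⟨⟨h3, fun r hr hr' => ?_⟩, h, fun r hr hr' => ?_⟩ <;>
      · have := h2 r
        have := h4 r
        have := eq_or_apply_ne μ r a
        have := eq_or_apply_ne μ r b
        have := eq_or_apply_ne μ r c
        grind
  · rintro (⟨⟨h1, h2⟩, h3, h4⟩ | ⟨⟨h1, h2⟩, h3, h4⟩)
    · refine ⟨⟨h3, fun r hr hr' => ?_⟩, by order, fun r hr hr' => ?_⟩ <;>
      · have := h2 r
        have := h4 r
        have := eq_or_apply_ne μ r a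
        have := eq_or_apply_ne μ r b
        have := eq_or_apply_ne μ r c
        grind
    · have := h2 b
      refine ⟨⟨by grind, fun r hr hr' => ?_⟩, by order, fun r hr hr' => ?_⟩ <;>
      · have := h2 r
        have := h4 r
        have := eq_or_apply_ne μ r a
        have := eq_or_apply_ne μ r b
        have := eq_or_apply_ne μ r c
        grind

theorem app_add_op (x : Perm (Fin n) →₀ R) (f g : Op R n) :
    app x (f + g) = app x f + app x g := rfl

theorem app_sub_op (x : Perm (Fin n) →₀ R) (f g : Op R n) :
    app x (f - g) = app x f - app x g := rfl

/-- The two terms on the right never act on the same `K_μ`: the first needs `μ b < μ c`, the second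
`μ c < μ b`. -/
theorem top_ab_bc {a b c : Fin n} (hab : a < b) (hbc : b < c) :
    top R a b * top R b c = top R b c * top R a c + top R a c * top R a b := by
  classical
  have hac := hab.trans hbc
  apply op_ext
  intro μ
  rw [app_mul, app_add_op, app_mul, app_mul]
  rw [app_top_top hab hbc, app_top_top hbc hac, app_top_top hac hab]
  have e1 : swap b c * swap a c = swap a b * swap b c := by
    rw [mul_swap_eq_swap_mul, swap_apply_of_ne_of_ne hab.ne hac.ne, swap_apply_right]
  have e2 : swap a c * swap a b = swap a b * swap b c := by
    rw [mul_swap_eq_swap_mul, swap_apply_left, swap_apply_of_ne_of_ne hab.ne' hbc.ne,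
      swap_comm c b, e1]
  rw [e1, e2]
  have key := cov_ab_bc hab hbc μ
  by_cases h1 : Cov μ b c ∧ Cov (μ * swap b c) a c
  · have h2 : ¬ (Cov μ a c ∧ Cov (μ * swap a c) a b) := by
      rintro ⟨_, h⟩
      have := h.1
      simp only [Perm.mul_apply, swap_apply_left, swap_apply_of_ne_of_ne hab.ne' hbc.ne] at this
      exact lt_asymm this h1.1.1
    rw [if_pos h1, if_neg h2, if_pos (key.2 (Or.inl h1)), add_zero]
  · by_cases h2 : Cov μ a c ∧ Cov (μ * swap a c) a b
    · rw [if_neg h1, if_pos h2, if_pos (key.2 (Or.inr h2)), zero_add]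
    · rw [if_neg h1, if_neg h2, if_neg (fun h => (key.1 h).elim h1 h2), zero_add]

theorem top_bc_ab {a b c : Fin n} (hab : a < b) (hbc : b < c) :
    top R b c * top R a b = top R a b * top R a c + top R a c * top R b c := by
  classical
  have hac := hab.trans hbc
  apply op_ext
  intro μ
  rw [app_mul, app_add_op, app_mul, app_mul]
  rw [app_top_top hbc hab, app_top_top hab hac, app_top_top hac hbc]
  have e1 : swap a b * swap a c = swap b c * swap a b := by
    rw [mul_swap_eq_swap_mul, swap_apply_left, swap_apply_of_ne_of_ne hac.ne' hbc.ne']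
  have e2 : swap a c * swap b c = swap b c * swap a b := by
    rw [mul_swap_eq_swap_mul, swap_apply_of_ne_of_ne hab.ne' hbc.ne, swap_apply_right,
      swap_comm b a, mul_swap_eq_swap_mul, swap_apply_left,
      swap_apply_of_ne_of_ne hac.ne' hbc.ne']
  rw [e1, e2]
  have key := cov_bc_ab hab hbc μ
  by_cases h1 : Cov μ a b ∧ Cov (μ * swap a b) a c
  · have h2 : ¬ (Cov μ a c ∧ Cov (μ * swap a c) b c) := by
      rintro ⟨_, h⟩
      have := h.1
      simp only [Perm.mul_apply, swap_apply_right, swap_apply_of_ne_of_ne hab.ne' hbc.ne] at this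
      exact lt_asymm this h1.1.1
    rw [if_pos h1, if_neg h2, if_pos (key.2 (Or.inl h1)), add_zero]
  · by_cases h2 : Cov μ a c ∧ Cov (μ * swap a c) b c
    · rw [if_neg h1, if_pos h2, if_pos (key.2 (Or.inr h2)), zero_add]
    · rw [if_neg h1, if_neg h2, if_neg (fun h => (key.1 h).elim h1 h2), zero_add]

/-- The quadratic terms agree by `h1` and `h2`. The cubic ones agree because `x * z * x`, expanded
in two ways with `x * x = 0`, equals both of them. -/
theorem one_sub_mul_yangBaxter {A : Type*} [Ring A] {x y z : A} (h1 : x * z = z * y + y * x)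
    (h2 : z * x = x * y + y * z) (hx : x * x = 0) :
    (1 - x) * (1 - y) * (1 - z) = (1 - z) * (1 - y) * (1 - x) := by
  have h3 : x * y * z = z * y * x := by
    have e1 : x * (z * x) = x * y * z := by
      rw [h2, mul_add, ← mul_assoc, hx, zero_mul, zero_add, mul_assoc]
    have e2 : x * (z * x) = z * y * x := by
      rw [← mul_assoc, h1, add_mul, mul_assoc y, hx, mul_zero, add_zero]
    rw [← e1, e2]
  simp only [mul_sub, sub_mul, mul_one, one_mul, h3, h1, h2]
  abel

/-- The Yang–Baxter equation. -/
theorem rop_yangBaxter {a b c : Fin n} (hab : a < b) (hbc : b < c) :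
    rop R a b * rop R a c * rop R b c = rop R b c * rop R a c * rop R a b := by
  rw [rop_eq, rop_eq, rop_eq]
  exact one_sub_mul_yangBaxter (A := Op R n) (top_ab_bc hab hbc) (top_bc_ab hab hbc) (top_mul_self hab)

/-! ### Commutation with simple operators -/

theorem app_pi_of_gt {i : Fin (n - 1)} {μ : Perm (Fin n)} (h : μ (rgt i) < μ (lft i)) :
    app (K R μ) (qop R 0 1 i) = K R (μ * simple i) := by
  rw [app_qop_of_gt _ _ h, zero_smul, add_zero]

theorem app_pi_of_lt {i : Fin (n - 1)} {μ : Perm (Fin n)} (h : μ (lft i) < μ (rgt i)) :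
    app (K R μ) (qop R 0 1 i) = K R μ := by
  rw [app_qop_of_lt _ _ h, one_smul]

@[simp] theorem app_smul (e : R) (x : Perm (Fin n) →₀ R) (f : Op R n) :
    app (e • x) f = e • app x f := map_smul f.unop e x

/-- The positions `lft i` and `rgt i` are adjacent, so both or neither lie between `a` and `b`. -/
theorem cov_mul_simple {a b : Fin n} {i : Fin (n - 1)} (ha : a ≠ lft i) (ha' : a ≠ rgt i)
    (hb : b ≠ lft i) (hb' : b ≠ rgt i) (μ : Perm (Fin n)) (h : Cov μ a b) :
    Cov (μ * simple i) a b := by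
  have hv := rgt_val i
  simp only [Cov, Perm.mul_apply, simple_eq, swap_apply_of_ne_of_ne ha ha',
    swap_apply_of_ne_of_ne hb hb'] at h ⊢
  refine ⟨h.1, fun r hr hr' => ?_⟩
  rw [swap_apply_def]
  have h1 := h.2 (lft i)
  have h2 := h.2 (rgt i)
  have h3 := h.2 r
  simp only [ne_eq, Fin.ext_iff, Fin.lt_def] at *
  grind

theorem rop_commute_qop {a b : Fin n} (hab : a < b) {i : Fin (n - 1)} (ha : a ≠ lft i)
    (ha' : a ≠ rgt i) (hb : b ≠ lft i) (hb' : b ≠ rgt i) (e d : R) :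
    Commute (rop R a b) (qop R e d i) := by
  apply op_ext
  intro μ
  have hc : Cov (μ * simple i) a b ↔ Cov μ a b := by
    refine ⟨fun h => ?_, cov_mul_simple ha ha' hb hb' μ⟩
    have := cov_mul_simple ha ha' hb hb' _ h
    rwa [mul_assoc, simple_eq, swap_mul_self, mul_one] at this
  have hs : swap a b * simple i = simple i * swap a b := by
    rw [simple_eq]
    exact (Perm.disjoint_swap_swap (by simp [ha, ha', hb, hb', hab.ne, lft_ne_rgt])).commute
  have hl : (μ * swap a b) (lft i) = μ (lft i) := by
    rw [Perm.mul_apply, swap_apply_of_ne_of_ne ha.symm hb.symm]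
  have hr : (μ * swap a b) (rgt i) = μ (rgt i) := by
    rw [Perm.mul_apply, swap_apply_of_ne_of_ne ha'.symm hb'.symm]
  rw [app_mul, app_mul]
  rcases lt_or_gt_simple μ i with h | h <;> by_cases h2 : Cov μ a b
  · rw [app_rop_of_cov hab h2, app_sub, app_qop_of_lt _ _ h, app_qop_of_lt _ _ (by rwa [hl, hr]),
      app_smul, app_rop_of_cov hab h2, smul_sub]
  · rw [app_rop_of_not_cov hab h2, app_qop_of_lt _ _ h, app_smul, app_rop_of_not_cov hab h2]
  · rw [app_rop_of_cov hab h2, app_sub, app_qop_of_gt _ _ h, app_qop_of_gt _ _ (by rwa [hl, hr]),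
      app_add, app_smul, app_rop_of_cov hab h2, app_rop_of_cov hab (hc.2 h2), smul_sub,
      mul_assoc, mul_assoc, hs]
    abel
  · rw [app_rop_of_not_cov hab h2, app_qop_of_gt _ _ h, app_add, app_smul,
      app_rop_of_not_cov hab h2, app_rop_of_not_cov hab (mt hc.1 h2)]

theorem cov_simple_iff (i : Fin (n - 1)) (μ : Perm (Fin n)) :
    Cov μ (lft i) (rgt i) ↔ μ (lft i) < μ (rgt i) := by
  refine ⟨fun h => h.1, fun h => ⟨h, fun r h1 h2 => ?_⟩⟩
  have := rgt_val i
  rw [Fin.lt_def] at h1 h2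
  omega

theorem lft_lt_rgt (i : Fin (n - 1)) : lft i < rgt i := by
  rw [Fin.lt_def, rgt_val]; omega

/-- The source of the sign: at an ascent, π̂_i kills `K_μ` and negates `K_μ - K_{μ s_i}`. -/
theorem rop_simple_mul_piHat (i : Fin (n - 1)) :
    rop R (lft i) (rgt i) * (qop R 0 1 i - 1) = qop R 0 (-1) i * rop R (lft i) (rgt i) := by
  apply op_ext
  intro μ
  have hi := lft_lt_rgt i
  rw [app_mul, app_mul]
  rw [app_sub_op]
  have hl : (μ * simple i) (lft i) = μ (rgt i) := by
    rw [Perm.mul_apply, simple_eq, swap_apply_left]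
  have hr : (μ * simple i) (rgt i) = μ (lft i) := by
    rw [Perm.mul_apply, simple_eq, swap_apply_right]
  have hss : μ * simple i * simple i = μ := by
    rw [mul_assoc, simple_eq, swap_mul_self, mul_one]
  rcases lt_or_gt_simple μ i with h | h
  · rw [app_rop_of_cov hi ((cov_simple_iff i μ).2 h), app_sub, app_pi_of_lt h, ← simple_eq,
      app_pi_of_gt (by rwa [hl, hr]), hss, app_qop_of_lt _ _ h, app_smul,
      app_rop_of_cov hi ((cov_simple_iff i μ).2 h), app_one, ← simple_eq, neg_one_smul]
    abel
  · rw [app_rop_of_not_cov hi (fun h' => lt_asymm h h'.1), app_pi_of_gt h, app_one,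
      app_qop_of_gt _ _ h, zero_smul, add_zero,
      app_rop_of_cov hi ((cov_simple_iff i _).2 (by rwa [hl, hr])), ← simple_eq, hss]

end YangBaxter

set_option linter.unusedSimpArgs false

/-! ### Effect on covers of swapping two adjacent positions -/

/-- `hgap` says that `p` and `q` are adjacent. The two rectangles differ only by position `q`, whose
letter `μ q` lies below them. -/
theorem cov_mul_swap_right_iff {n : ℕ} {p q c : Fin n} (hpq : p < q) (hqc : q < c)
    (hgap : ∀ r, p < r → r ≠ q → q < r) (μ : Perm (Fin n)) (h : μ q < μ p) :
    Cov (μ * swap p q) q c ↔ Cov μ p c := by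
  have hpc := hpq.trans hqc
  simp only [Cov, Perm.mul_apply, swap_apply_def]
  simp only [hpq.ne, hpq.ne', hqc.ne, hqc.ne', hpc.ne, hpc.ne', if_false, if_true]
  refine and_congr_right fun h1 => forall_congr' fun r => ?_
  have := hgap r
  by_cases hr : r = q
  · subst hr; simp [lt_asymm h]
  by_cases hr' : r = p
  · subst hr'; simp [hpq.not_gt]
  simp only [hr, hr', if_false]
  have : q < r → p < r := hpq.trans
  tauto

theorem cov_mul_swap_left_iff {n : ℕ} {p q c : Fin n} (hpq : p < q) (hqc : q < c)
    (hgap : ∀ r, p < r → r ≠ q → q < r) (μ : Perm (Fin n)) (h : μ c < μ p) :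
    Cov (μ * swap p q) p c ↔ Cov μ q c := by
  have hpc := hpq.trans hqc
  simp only [Cov, Perm.mul_apply, swap_apply_def]
  simp only [hpq.ne, hpq.ne', hqc.ne, hqc.ne', hpc.ne, hpc.ne', if_false, if_true]
  refine and_congr_right fun h1 => forall_congr' fun r => ?_
  have := hgap r
  by_cases hr : r = q
  · subst hr; simp [hpq.ne', h.le]
  by_cases hr' : r = p
  · subst hr'; simp [hpq.le]
  simp only [hr, hr', if_false]
  have : q < r → p < r := hpq.trans
  tauto

/-- The swap lowers the top of the rectangle from `μ c` to `μ p`; the strip removed contains no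
point because `(p, c)` is a cover. -/
theorem cov_mul_swap_cov_iff {n : ℕ} {p q c : Fin n} (hpq : p < q) (hqc : q < c) (μ : Perm (Fin n))
    (h : μ q < μ p) (h1 : Cov μ p c) :
    Cov (μ * swap p c) q c ↔ Cov μ q c := by
  have hpc := hpq.trans hqc
  simp only [Cov, Perm.mul_apply, swap_apply_def] at *
  simp only [hpq.ne, hpq.ne', hqc.ne, hqc.ne', hpc.ne, hpc.ne', if_false, if_true] at *
  have h2 := h.trans h1.1
  simp only [h, h2, true_and]
  refine forall_congr' fun r => ?_
  have := h1.2 r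
  by_cases hr : r = p
  · subst hr; simp [hpq.le]
  by_cases hr' : r = c
  · subst hr'; simp
  simp only [hr, hr', if_false]
  have e : μ r ≠ μ p := μ.injective.ne hr
  have : q < r → p < r := hpq.trans
  have := h1.1
  have := lt_or_gt_of_ne e
  have : μ r < μ p → μ r < μ c := fun h => h.trans h1.1
  tauto

theorem cov_of_cov_right {n : ℕ} {p q c : Fin n} (hpq : p < q) (hqc : q < c)
    (hgap : ∀ r, p < r → r ≠ q → q < r) (μ : Perm (Fin n)) (h : μ q < μ p) (h' : μ p < μ c)
    (h1 : Cov μ q c) : Cov μ p c := by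
  refine ⟨h', fun r hr hr' h3 h4 => ?_⟩
  by_cases e : r = q
  · subst e; exact lt_asymm h h3
  · exact h1.2 r (hgap r hr e) hr' (h.trans h3) h4

theorem cov_left_mul_swap_iff {n : ℕ} {p q a : Fin n} (hpq : p < q) (ha : a < p)
    (hgap : ∀ r, p < r → r ≠ q → q < r) (μ : Perm (Fin n)) (h : μ q < μ p) :
    Cov (μ * swap p q) a p ↔ Cov μ a q := by
  have haq := ha.trans hpq
  simp only [Cov, Perm.mul_apply, swap_apply_def]
  simp only [hpq.ne, hpq.ne', ha.ne, ha.ne', haq.ne, haq.ne', if_false, if_true]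
  refine and_congr_right fun h1 => forall_congr' fun r => ?_
  have := hgap r
  by_cases hr : r = q
  · subst hr; simp [hpq.le]
  by_cases hr' : r = p
  · subst hr'; simp [lt_asymm h]
  simp only [hr, hr', if_false]
  have : r < q ↔ r < p := by
    refine ⟨fun h => ?_, fun h => h.trans hpq⟩
    rcases lt_trichotomy r p with h1 | h1 | h1
    · exact h1
    · exact absurd h1 hr'
    · exact absurd h (lt_asymm (this h1 hr))
  rw [this]

theorem cov_left_mul_swap_iff' {n : ℕ} {p q a : Fin n} (hpq : p < q) (ha : a < p)
    (hgap : ∀ r, p < r → r ≠ q → q < r) (μ : Perm (Fin n)) (h : μ q < μ a) :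
    Cov (μ * swap p q) a q ↔ Cov μ a p := by
  have haq := ha.trans hpq
  simp only [Cov, Perm.mul_apply, swap_apply_def]
  simp only [hpq.ne, hpq.ne', ha.ne, ha.ne', haq.ne, haq.ne', if_false, if_true]
  refine and_congr_right fun h1 => forall_congr' fun r => ?_
  have := hgap r
  by_cases hr : r = q
  · subst hr; simp [hpq.le]
  by_cases hr' : r = p
  · subst hr'; simp [lt_asymm h]
  simp only [hr, hr', if_false]
  have : r < q ↔ r < p := by
    refine ⟨fun h => ?_, fun h => h.trans hpq⟩
    rcases lt_trichotomy r p with h1 | h1 | h1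
    · exact h1
    · exact absurd h1 hr'
    · exact absurd h (lt_asymm (this h1 hr))
  rw [this]

theorem cov_left_mul_swap_cov_iff {n : ℕ} {p q a : Fin n} (hpq : p < q) (ha : a < p)
    (μ : Perm (Fin n)) (h : μ q < μ p) (h1 : Cov μ a q) :
    Cov (μ * swap a q) a p ↔ Cov μ a p := by
  have haq := ha.trans hpq
  simp only [Cov, Perm.mul_apply, swap_apply_def] at *
  simp only [hpq.ne, hpq.ne', ha.ne, ha.ne', haq.ne, haq.ne', if_false, if_true] at *
  have h2 := h1.1.trans h
  simp only [h, h2, true_and]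
  refine forall_congr' fun r => ?_
  have := h1.2 r
  by_cases hr : r = a
  · subst hr; simp
  by_cases hr' : r = q
  · subst hr'; simp [hpq.le]
  simp only [hr, hr', if_false]
  have e : μ r ≠ μ q := μ.injective.ne hr'
  have : r < p → r < q := fun h => h.trans hpq
  have := lt_or_gt_of_ne e
  have : μ q < μ r → μ a < μ r := fun h => h1.1.trans h
  tauto

theorem cov_of_cov_left {n : ℕ} {p q a : Fin n} (hpq : p < q)
    (hgap : ∀ r, p < r → r ≠ q → q < r) (μ : Perm (Fin n)) (h : μ q < μ p) (h' : μ a < μ q)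
    (h1 : Cov μ a p) : Cov μ a q := by
  refine ⟨h', fun r hr hr' h3 h4 => ?_⟩
  rcases lt_trichotomy r p with e | e | e
  · exact h1.2 r hr e h3 (h4.trans h)
  · subst e; exact lt_asymm h h4
  · exact lt_asymm hr' (hgap r e hr'.ne)

theorem swap_mul_swap_left_right {n : ℕ} {p q c : Fin n} (hp : c ≠ p) (hq : c ≠ q) :
    swap p q * swap q c = swap p c * swap p q := by
  rw [mul_swap_eq_swap_mul, swap_apply_right, swap_apply_of_ne_of_ne hp hq]

theorem swap_mul_swap_left_left {n : ℕ} {p q c : Fin n} (hp : c ≠ p) (hq : c ≠ q) :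
    swap p q * swap p c = swap q c * swap p q := by
  rw [mul_swap_eq_swap_mul, swap_apply_left, swap_apply_of_ne_of_ne hp hq]

theorem swap_mul_swap_mul_swap_right {n : ℕ} {p q c : Fin n} (hp : c ≠ p) (hq : c ≠ q)
    (hpq : p ≠ q) : swap p c * swap q c * swap p q = swap q c := by
  have h : swap p c * swap q c = swap q c * swap p q := by
    rw [mul_swap_eq_swap_mul, swap_apply_right, swap_apply_of_ne_of_ne hpq.symm hq.symm,
      swap_comm q p, swap_mul_swap_left_left hp hq]
  rw [h, mul_assoc, swap_mul_self, mul_one]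

/-! ### Pairs of transpositions meeting a simple one commute with π_i -/

section Adjacent

variable {R : Type*} [CommRing R] {n : ℕ}

theorem gap_simple (i : Fin (n - 1)) (r : Fin n) (h : lft i < r) (h' : r ≠ rgt i) : rgt i < r := by
  have hv := rgt_val i
  simp only [ne_eq, Fin.ext_iff, Fin.lt_def] at *
  omega

/-- At an ascent of `μ`, every term produced by the pair still has an ascent at `i`, so π_i fixes
them all. At a descent, `s_i` exchanges the roles of `(p, c)` and `(q, c)`, and the terms match or
cancel. -/
theorem rop_right_pair_commute_pi {c : Fin n} {i : Fin (n - 1)} (hqc : rgt i < c) :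
    Commute (rop R (lft i) c * rop R (rgt i) c) (qop R 0 1 i) := by
  apply op_ext
  intro μ
  have hpq := lft_lt_rgt i
  have hs := simple_eq i
  have hpi := @app_pi_of_gt R _ n i
  have hpi' := @app_pi_of_lt R _ n i
  have hgap := gap_simple i
  generalize lft i = p at *
  generalize rgt i = q at *
  rw [hs] at hpi
  have hpc := hpq.trans hqc
  have e1 := swap_mul_swap_left_right hpc.ne' hqc.ne'
  have e2 := swap_mul_swap_left_left hpc.ne' hqc.ne'
  have e3 := swap_mul_swap_mul_swap_right hpc.ne' hqc.ne' hpq.ne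
  have vp : ∀ ν : Perm (Fin n), (ν * swap p c) p = ν c := fun ν => by simp
  have vq : ∀ ν : Perm (Fin n), (ν * swap p c) q = ν q := fun ν => by
    rw [Perm.mul_apply, swap_apply_of_ne_of_ne hpq.ne' hqc.ne]
  have vc : ∀ ν : Perm (Fin n), (ν * swap p c) c = ν p := fun ν => by simp
  have wp : ∀ ν : Perm (Fin n), (ν * swap q c) p = ν p := fun ν => by
    rw [Perm.mul_apply, swap_apply_of_ne_of_ne hpq.ne hpc.ne]
  have wq : ∀ ν : Perm (Fin n), (ν * swap q c) q = ν c := fun ν => by simp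
  have sp : (μ * swap p q) p = μ q := by simp
  have sq : (μ * swap p q) q = μ p := by simp
  have sc : (μ * swap p q) c = μ c := by
    rw [Perm.mul_apply, swap_apply_of_ne_of_ne hpc.ne' hqc.ne']
  rw [app_mul, app_mul, app_mul, app_mul]
  rcases lt_or_gt_of_ne (μ.injective.ne hpq.ne) with h | h
  · rw [hpi' h]
    have g2' : Cov μ q c → app (K R (μ * swap q c)) (qop R 0 1 i) = K R (μ * swap q c) :=
      fun g2 => hpi' (by rw [wp, wq]; exact h.trans g2.1)
    by_cases g1 : Cov μ p c
    · have hzy : μ c < μ q := lt_of_le_of_ne (not_lt.1 fun h' => g1.2 q hpq hqc h h')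
        (μ.injective.ne hqc.ne')
      have g2 : ¬ Cov μ q c := fun g => lt_asymm hzy g.1
      have g3 : ¬ Cov (μ * swap p c) q c := fun g => by
        have := g.1; rw [vq, vc] at this; exact lt_asymm h this
      rw [app_rop_of_cov hpc g1, app_sub, app_rop_of_not_cov hqc g2, app_rop_of_not_cov hqc g3,
        app_sub, hpi' h, hpi' (by rwa [vp, vq])]
    · rw [app_rop_of_not_cov hpc g1]
      by_cases g2 : Cov μ q c
      · rw [app_rop_of_cov hqc g2, app_sub, hpi' h, g2' g2]
      · rw [app_rop_of_not_cov hqc g2, hpi' h]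
  · rw [hpi h]
    have k1 := cov_mul_swap_right_iff hpq hqc hgap μ h
    rcases lt_or_gt_of_ne (μ.injective.ne hpc.ne) with hz | hz
    · have n1 : ¬ Cov (μ * swap p q) p c := fun g => by
        refine g.2 q hpq hqc ?_ ?_
        · rwa [sp, sq]
        · rwa [sc, sq]
      rw [app_rop_of_not_cov hpc n1]
      by_cases g1 : Cov μ p c
      · have k2 := cov_mul_swap_cov_iff hpq hqc μ h g1
        have d1 : app (K R (μ * swap p c)) (qop R 0 1 i) = K R (μ * swap p c * swap p q) :=
          hpi (by rw [vp, vq]; exact h.trans hz)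
        rw [app_rop_of_cov hpc g1, app_rop_of_cov hqc (k1.2 g1), app_sub]
        have e : μ * swap p q * swap q c = μ * swap p c * swap p q := by
          rw [mul_assoc, e1, mul_assoc]
        -- If both are covers, π_i fixes the term of `(q, c)` and sends that of `(p, c)(q, c)` to
        -- it; their signs are opposite, so they cancel.
        by_cases g2 : Cov μ q c
        · rw [app_rop_of_cov hqc g2, app_rop_of_cov hqc (k2.2 g2), app_sub, app_sub, app_sub,
            hpi h, d1, hpi' (μ := μ * swap q c) (by rwa [wp, wq]),
            hpi (μ := μ * swap p c * swap q c) (by rw [wp, wq, vp, vc]; exact hz),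
            mul_assoc, mul_assoc, mul_assoc μ, ← mul_assoc (swap p c), e3, e, mul_assoc]
          abel
        · rw [app_rop_of_not_cov hqc g2, app_rop_of_not_cov hqc (mt k2.1 g2), app_sub, hpi h, d1, e]
      · have g2 : ¬ Cov μ q c := fun g2 => g1 (cov_of_cov_right hpq hqc hgap μ h hz g2)
        rw [app_rop_of_not_cov hpc g1, app_rop_of_not_cov hqc g2, hpi h,
          app_rop_of_not_cov hqc (mt k1.1 g1)]
    · have k3 := cov_mul_swap_left_iff hpq hqc hgap μ hz
      have g1 : ¬ Cov μ p c := fun g => lt_asymm hz g.1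
      rw [app_rop_of_not_cov hpc g1]
      by_cases g2 : Cov μ q c
      · have n2 : ¬ Cov (μ * swap p q * swap p c) q c := fun g => by
          have := g.1; rw [vq, vc, sp, sq] at this; exact lt_asymm h this
        rw [app_rop_of_cov hqc g2, app_rop_of_cov hpc (k3.2 g2), app_sub, app_sub, hpi h,
          app_rop_of_not_cov hqc (mt k1.1 g1), app_rop_of_not_cov hqc n2,
          hpi (by rwa [wp, wq]), mul_assoc, mul_assoc, e2]
      · rw [app_rop_of_not_cov hqc g2, app_rop_of_not_cov hpc (mt k3.1 g2), hpi h,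
          app_rop_of_not_cov hqc (mt k1.1 g1)]

/-- Mirror image of `rop_right_pair_commute_pi`: reversing positions and values preserves covers and
exchanges `lft` and `rgt`, whence the order of the factors. -/
theorem rop_left_pair_commute_pi {a : Fin n} {i : Fin (n - 1)} (ha : a < lft i) :
    Commute (rop R a (rgt i) * rop R a (lft i)) (qop R 0 1 i) := by
  apply op_ext
  intro μ
  have hpq := lft_lt_rgt i
  have hs := simple_eq i
  have hpi := @app_pi_of_gt R _ n i
  have hpi' := @app_pi_of_lt R _ n i
  have hgap := gap_simple i
  generalize lft i = p at *
  generalize rgt i = q at *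
  rw [hs] at hpi
  have haq := ha.trans hpq
  have e1 : swap p q * swap a q = swap a p * swap p q := by
    rw [swap_comm a q, swap_comm a p, swap_mul_swap_left_right ha.ne haq.ne]
  have e2 : swap p q * swap a p = swap a q * swap p q := by
    rw [swap_comm a q, swap_comm a p, swap_mul_swap_left_left ha.ne haq.ne]
  have e3 : swap a q * swap a p * swap p q = swap a p := by
    rw [swap_comm a q, swap_comm a p, swap_comm p q,
      swap_mul_swap_mul_swap_right haq.ne ha.ne hpq.ne']
  have vp : ∀ ν : Perm (Fin n), (ν * swap a p) p = ν a := fun ν => by simp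
  have vq : ∀ ν : Perm (Fin n), (ν * swap a p) q = ν q := fun ν => by
    rw [Perm.mul_apply, swap_apply_of_ne_of_ne haq.ne' hpq.ne']
  have wp : ∀ ν : Perm (Fin n), (ν * swap a q) p = ν p := fun ν => by
    rw [Perm.mul_apply, swap_apply_of_ne_of_ne ha.ne' hpq.ne]
  have wq : ∀ ν : Perm (Fin n), (ν * swap a q) q = ν a := fun ν => by simp
  have wa : ∀ ν : Perm (Fin n), (ν * swap a q) a = ν q := fun ν => by simp
  have sp : (μ * swap p q) p = μ q := by simp
  have sq : (μ * swap p q) q = μ p := by simp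
  have sa : (μ * swap p q) a = μ a := by
    rw [Perm.mul_apply, swap_apply_of_ne_of_ne ha.ne haq.ne]
  rw [app_mul, app_mul, app_mul, app_mul]
  rcases lt_or_gt_of_ne (μ.injective.ne hpq.ne) with h | h
  · rw [hpi' h]
    by_cases g1 : Cov μ a q
    · have hxw : μ p < μ a := lt_of_le_of_ne (not_lt.1 fun h' => g1.2 p ha hpq h' h)
        (μ.injective.ne ha.ne')
      have g2 : ¬ Cov μ a p := fun g => lt_asymm hxw g.1
      have g3 : ¬ Cov (μ * swap a q) a p := fun g => by
        have := g.1; rw [wa, wp] at this; exact lt_asymm h this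
      rw [app_rop_of_cov haq g1, app_sub, app_rop_of_not_cov ha g2, app_rop_of_not_cov ha g3,
        app_sub, hpi' h, hpi' (by rwa [wp, wq])]
    · rw [app_rop_of_not_cov haq g1]
      by_cases g2 : Cov μ a p
      · rw [app_rop_of_cov ha g2, app_sub, hpi' h, hpi' (by rw [vp, vq]; exact g2.1.trans h)]
      · rw [app_rop_of_not_cov ha g2, hpi' h]
  · rw [hpi h]
    have k1 := cov_left_mul_swap_iff hpq ha hgap μ h
    rcases lt_or_gt_of_ne (μ.injective.ne haq.ne) with hw | hw
    · have n1 : ¬ Cov (μ * swap p q) a q := fun g => by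
        refine g.2 p ha hpq ?_ ?_
        · rwa [sa, sp]
        · rwa [sp, sq]
      rw [app_rop_of_not_cov haq n1]
      by_cases g1 : Cov μ a q
      · have k2 := cov_left_mul_swap_cov_iff hpq ha μ h g1
        have d1 : app (K R (μ * swap a q)) (qop R 0 1 i) = K R (μ * swap a q * swap p q) :=
          hpi (by rw [wp, wq]; exact hw.trans h)
        have e : μ * swap p q * swap a p = μ * swap a q * swap p q := by
          rw [mul_assoc, e2, mul_assoc]
        rw [app_rop_of_cov haq g1, app_rop_of_cov ha (k1.2 g1), app_sub]
        by_cases g2 : Cov μ a p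
        · rw [app_rop_of_cov ha g2, app_rop_of_cov ha (k2.2 g2), app_sub, app_sub, app_sub,
            hpi h, d1, hpi' (μ := μ * swap a p) (by rwa [vp, vq]),
            hpi (μ := μ * swap a q * swap a p) (by rw [vp, vq, wa, wq]; exact hw),
            mul_assoc, mul_assoc, mul_assoc μ, ← mul_assoc (swap a q), e3, e, mul_assoc]
          abel
        · rw [app_rop_of_not_cov ha g2, app_rop_of_not_cov ha (mt k2.1 g2), app_sub, hpi h, d1, e]
      · have g2 : ¬ Cov μ a p := fun g2 => g1 (cov_of_cov_left hpq hgap μ h hw g2)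
        rw [app_rop_of_not_cov haq g1, app_rop_of_not_cov ha g2, hpi h,
          app_rop_of_not_cov ha (mt k1.1 g1)]
    · have k3 := cov_left_mul_swap_iff' hpq ha hgap μ hw
      have g1 : ¬ Cov μ a q := fun g => lt_asymm hw g.1
      rw [app_rop_of_not_cov haq g1]
      by_cases g2 : Cov μ a p
      · have n2 : ¬ Cov (μ * swap p q * swap a q) a p := fun g => by
          have := g.1; rw [wa, wp, sp, sq] at this; exact lt_asymm h this
        rw [app_rop_of_cov ha g2, app_rop_of_cov haq (k3.2 g2), app_sub, app_sub, hpi h,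
          app_rop_of_not_cov ha (mt k1.1 g1), app_rop_of_not_cov ha n2,
          hpi (by rwa [vp, vq]), mul_assoc, mul_assoc, e1]
      · rw [app_rop_of_not_cov ha g2, app_rop_of_not_cov haq (mt k3.1 g2), hpi h,
          app_rop_of_not_cov ha (mt k1.1 g1)]

end Adjacent

section Columns

variable (R : Type*) [CommRing R] (n : ℕ)

/-! ### Products over columns of transpositions -/

/-- The operator `1 - (a, b)` with natural numbers as indices; the identity out of range. -/
noncomputable def rn (a b : ℕ) : Op R n :=
  if h : a < n ∧ b < n then rop R ⟨a, h.1⟩ ⟨b, h.2⟩ else 1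

/-- The product over `(0, c), (1, c), …, (m - 1, c)`. -/
noncomputable def col : ℕ → ℕ → Op R n
  | 0, _ => 1
  | m + 1, c => col m c * rn R n m c

/-- The product over the columns `k + d - 1, …, k + 1, k`, restricted to the first `k` rows. -/
noncomputable def descCols (k : ℕ) : ℕ → Op R n
  | 0 => 1
  | d + 1 => col R n k (k + d) * descCols k d

/-- The product over the full columns `1, 2, …, m - 1`. -/
noncomputable def ascCols : ℕ → Op R n
  | 0 => 1
  | m + 1 => ascCols m * col R n m m

/-- The product over `(k, c), (k + 1, c), …, (k + j - 1, c)`. -/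
noncomputable def lowCol (k c : ℕ) : ℕ → Op R n
  | 0 => 1
  | j + 1 => lowCol k c j * rn R n (k + j) c

variable {R n}

theorem rn_commute {a b c d : ℕ} (hab : a < b) (hcd : c < d) (hac : a ≠ c) (had : a ≠ d)
    (hbc : b ≠ c) (hbd : b ≠ d) : Commute (rn R n a b) (rn R n c d) := by
  unfold rn
  split_ifs with h1 h2
  · exact rop_commute hab hcd (by simpa [Fin.ext_iff]) (by simpa [Fin.ext_iff])
      (by simpa [Fin.ext_iff]) (by simpa [Fin.ext_iff])
  · exact Commute.one_right _
  · exact Commute.one_left _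
  · exact Commute.one_left _

theorem rn_yangBaxter {a b c : ℕ} (hab : a < b) (hbc : b < c) :
    rn R n a b * rn R n a c * rn R n b c = rn R n b c * rn R n a c * rn R n a b := by
  by_cases hc : c < n
  · have hb := hbc.trans hc
    have ha := hab.trans hb
    simp only [rn, ha, hb, hc, and_self, dif_pos]
    exact rop_yangBaxter hab hbc
  · simp only [rn, hc, and_false, dif_neg, not_false_eq_true]
    rw [mul_one, mul_one, one_mul, one_mul]

theorem rn_commute_qop {a b : ℕ} (hab : a < b) {i : Fin (n - 1)} (ha : a ≠ i.val)
    (ha' : a ≠ i.val + 1) (hb : b ≠ i.val) (hb' : b ≠ i.val + 1) (e d : R) :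
    Commute (rn R n a b) (qop R e d i) := by
  unfold rn
  split_ifs with h
  · exact rop_commute_qop hab (by simpa [Fin.ext_iff]) (by simpa [Fin.ext_iff])
      (by simpa [Fin.ext_iff]) (by simpa [Fin.ext_iff]) e d
  · exact Commute.one_left _

theorem rn_right_pair_commute_pi {c : ℕ} {i : Fin (n - 1)} (hc : i.val + 1 < c) :
    Commute (rn R n i.val c * rn R n (i.val + 1) c) (qop R 0 1 i) := by
  by_cases h : c < n
  · have h1 : i.val + 1 < n := by omega
    have h2 : i.val < n := by omega
    simp only [rn, h, h1, h2, and_self, dif_pos]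
    exact rop_right_pair_commute_pi (i := i) (c := ⟨c, h⟩) hc
  · simp only [rn, h, and_false, dif_neg, not_false_eq_true]
    rw [mul_one]; exact Commute.one_left _

theorem rn_left_pair_commute_pi {a : ℕ} {i : Fin (n - 1)} (ha : a < i.val) :
    Commute (rn R n a (i.val + 1) * rn R n a i.val) (qop R 0 1 i) := by
  have h1 : i.val + 1 < n := by omega
  have h2 : i.val < n := by omega
  have h3 : a < n := by omega
  simp only [rn, h1, h2, h3, and_self, dif_pos]
  exact rop_left_pair_commute_pi (i := i) (a := ⟨a, h3⟩) ha

theorem rn_simple_mul_piHat (i : Fin (n - 1)) :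
    rn R n i.val (i.val + 1) * (qop R 0 1 i - 1) =
      qop R 0 (-1) i * rn R n i.val (i.val + 1) := by
  have h1 : i.val + 1 < n := by omega
  have h2 : i.val < n := by omega
  simp only [rn, h1, h2, and_self, dif_pos]
  exact rop_simple_mul_piHat i

theorem col_commute_of_forall {x : Op R n} {m c : ℕ} (h : ∀ a < m, Commute (rn R n a c) x) :
    Commute (col R n m c) x := by
  induction m with
  | zero => exact Commute.one_left _
  | succ m ih => exact (ih fun a ha => h a (by omega)).mul_left (h m (by omega))

theorem rn_commute_col {m b c : ℕ} (hmb : m < b) (hmc : m < c) (hbc : b ≠ c) :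
    Commute (rn R n m b) (col R n m c) :=
  (col_commute_of_forall fun a ha =>
    rn_commute (by omega) hmb (by omega) (by omega) (by omega) hbc.symm).symm

/-- For `m ≠ i + 1`, rows `i` and `i + 1` are both absent or both present, and in the latter case
they form an adjacent commuting pair. -/
theorem col_commute_pi {m c : ℕ} {i : Fin (n - 1)} (hmc : m ≤ c) (hc : i.val + 1 < c)
    (hm : m ≠ i.val + 1) : Commute (col R n m c) (qop R 0 1 i) := by
  have low : ∀ m ≤ i.val, Commute (col R n m c) (qop R 0 1 i) := fun m hm =>
    col_commute_of_forall fun a ha =>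
      rn_commute_qop (by omega) (by omega) (by omega) (by omega) (by omega) _ _
  rcases Nat.lt_or_ge m (i.val + 1) with h | h
  · exact low m (by omega)
  · have h : i.val + 2 ≤ m := by omega
    clear hm
    induction m, h using Nat.le_induction with
    | base =>
      have := (low i.val le_rfl).mul_left (rn_right_pair_commute_pi hc)
      rwa [← mul_assoc] at this
    | succ m h ih =>
      exact (ih (by omega) (by omega)).mul_left
        (rn_commute_qop (by omega) (by omega) (by omega) (by omega) (by omega) _ _)

/-- Yang–Baxter row by row: `(b, c)` crosses two columns and reverses their order. -/
theorem col_mul_col_mul_rn {m b c : ℕ} (hmb : m ≤ b) (hbc : b < c) :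
    col R n m b * col R n m c * rn R n b c = rn R n b c * col R n m c * col R n m b := by
  induction m with
  | zero => simp [col]
  | succ m ih =>
    have ih := ih (by omega)
    have h1 : Commute (rn R n m b) (col R n m c) := rn_commute_col (by omega) (by omega) hbc.ne
    have h2 : Commute (rn R n m c) (col R n m b) := rn_commute_col (by omega) (by omega) hbc.ne'
    have h3 : rn R n m b * rn R n m c * rn R n b c = rn R n b c * rn R n m c * rn R n m b :=
      rn_yangBaxter (by omega) hbc
    calc col R n m b * rn R n m b * (col R n m c * rn R n m c) * rn R n b c
        = col R n m b * (rn R n m b * col R n m c) * rn R n m c * rn R n b c := by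
          simp only [mul_assoc]
      _ = col R n m b * col R n m c * (rn R n m b * rn R n m c * rn R n b c) := by
          rw [h1.eq]; simp only [mul_assoc]
      _ = col R n m b * col R n m c * rn R n b c * rn R n m c * rn R n m b := by
          rw [h3]; simp only [mul_assoc]
      _ = rn R n b c * col R n m c * (col R n m b * rn R n m c) * rn R n m b := by
          rw [ih]; simp only [mul_assoc]
      _ = rn R n b c * (col R n m c * rn R n m c) * (col R n m b * rn R n m b) := by
          rw [← h2.eq]; simp only [mul_assoc]

/-- The two columns interleave into pairs `(a, i + 1)(a, i)`, each commuting with π_i. -/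
theorem col_pair_commute_pi {m : ℕ} {i : Fin (n - 1)} (hm : m ≤ i.val) :
    Commute (col R n m (i.val + 1) * col R n m i.val) (qop R 0 1 i) := by
  induction m with
  | zero => simp [col]
  | succ m ih =>
    have h1 : Commute (rn R n m (i.val + 1)) (col R n m i.val) :=
      rn_commute_col (by omega) (by omega) (by omega)
    have e : col R n (m + 1) (i.val + 1) * col R n (m + 1) i.val =
        (col R n m (i.val + 1) * col R n m i.val) *
          (rn R n m (i.val + 1) * rn R n m i.val) := by
      simp only [col]
      rw [mul_assoc, ← mul_assoc (rn R n m (i.val + 1)), h1.eq]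
      simp only [mul_assoc]
    rw [e]
    exact (ih (by omega)).mul_left (rn_left_pair_commute_pi (by omega))

theorem descCols_commute_of_forall {x : Op R n} {k d : ℕ}
    (h : ∀ j < d, Commute (col R n k (k + j)) x) : Commute (descCols R n k d) x := by
  induction d with
  | zero => exact Commute.one_left _
  | succ d ih => exact (h d (by omega)).mul_left (ih fun a ha => h a (by omega))

/-- If `i < k`, each column commutes by itself. If `i ≥ k`, columns `i + 1` and `i` are consecutive,
in the order that `col_pair_commute_pi` requires. -/
theorem descCols_commute_pi {k d : ℕ} {i : Fin (n - 1)} (hk : i.val + 1 ≠ k)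
    (hd : i.val + 2 ≤ k + d) : Commute (descCols R n k d) (qop R 0 1 i) := by
  rcases Nat.lt_or_ge i.val k with h | h
  · exact descCols_commute_of_forall fun j hj => col_commute_pi (by omega) (by omega) hk.symm
  · obtain ⟨e, he⟩ := Nat.exists_eq_add_of_le h
    have h0 : Commute (descCols R n k e) (qop R 0 1 i) :=
      descCols_commute_of_forall fun j hj => col_commute_of_forall fun a ha =>
        rn_commute_qop (by omega) (by omega) (by omega) (by omega) (by omega) _ _
    have hd : e + 2 ≤ d := by omega
    induction d, hd using Nat.le_induction with
    | base =>
      have := (col_pair_commute_pi (R := R) h).mul_left h0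
      rw [he, mul_assoc] at this
      exact this
    | succ d hd' ih =>
      exact (col_commute_pi (by omega) (by omega) hk.symm).mul_left (ih (by omega))

theorem ascCols_commute_of_forall {x : Op R n} {m : ℕ}
    (h : ∀ c < m, Commute (col R n c c) x) : Commute (ascCols R n m) x := by
  induction m with
  | zero => exact Commute.one_left _
  | succ m ih => exact (ih fun a ha => h a (by omega)).mul_left (h m (by omega))

theorem commute_sub_one {x y : Op R n} (h : Commute x y) : Commute x (y - 1) :=
  Commute.sub_right (R := Op R n) h (Commute.one_right _)

/-- Yang–Baxter reverses columns `i` and `i + 1` and puts `(i, i + 1)` in front of them. All the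
other factors commute with the simple operator; this one turns π̂_i into `qop R 0 (-1) i`. -/
theorem ascCols_mul_piHat {m : ℕ} {i : Fin (n - 1)} (hm : i.val + 2 ≤ m) :
    ascCols R n m * (qop R 0 1 i - 1) = qop R 0 (-1) i * ascCols R n m := by
  have h0 : Commute (ascCols R n i.val) (qop R 0 (-1) i) :=
    ascCols_commute_of_forall fun c hc => col_commute_of_forall fun a ha =>
      rn_commute_qop (by omega) (by omega) (by omega) (by omega) (by omega) _ _
  induction m, hm using Nat.le_induction with
  | base =>
    have h1 : Commute (col R n i.val (i.val + 1) * col R n i.val i.val) (qop R 0 1 i - 1) :=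
      commute_sub_one (col_pair_commute_pi le_rfl)
    have h2 := col_mul_col_mul_rn (R := R) (n := n) (le_refl i.val) (Nat.lt_succ_self i.val)
    have h3 := rn_simple_mul_piHat (R := R) i
    have e : ascCols R n (i.val + 2) = ascCols R n i.val *
        (rn R n i.val (i.val + 1) * (col R n i.val (i.val + 1) * col R n i.val i.val)) := by
      simp only [ascCols, col]
      rw [← mul_assoc (rn R n i.val (i.val + 1)), ← h2]
      simp only [mul_assoc]
    rw [e, mul_assoc, mul_assoc, h1.eq, ← mul_assoc (rn R n i.val (i.val + 1)), h3,
      mul_assoc (qop R 0 (-1) i), ← mul_assoc, h0.eq, mul_assoc]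
  | succ m hm ih =>
    have h1 : Commute (col R n m m) (qop R 0 1 i - 1) :=
      commute_sub_one (col_commute_pi le_rfl (by omega) (by omega))
    simp only [ascCols]
    rw [mul_assoc, h1.eq, ← mul_assoc, ih, mul_assoc]

theorem col_add (k c j : ℕ) : col R n (k + j) c = col R n k c * lowCol R n k c j := by
  induction j with
  | zero => simp [lowCol]
  | succ j ih => rw [← add_assoc, col, ih, lowCol, mul_assoc]

theorem lowCol_commute_of_forall {x : Op R n} {k c j : ℕ}
    (h : ∀ l < j, Commute (rn R n (k + l) c) x) : Commute (lowCol R n k c j) x := by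
  induction j with
  | zero => exact Commute.one_left _
  | succ j ih => exact (ih fun a ha => h a (by omega)).mul_left (h j (by omega))

theorem descCols_mul_col_mul_lowCol {k c j : ℕ} (h : k + j ≤ c) :
    descCols R n k j * col R n k c * lowCol R n k c j =
      lowCol R n k c j * (col R n k c * descCols R n k j) := by
  induction j with
  | zero => simp [lowCol, descCols]
  | succ j ih =>
    have ih := ih (by omega)
    have h1 : Commute (col R n k (k + j)) (lowCol R n k c j) :=
      (lowCol_commute_of_forall fun l hl => (col_commute_of_forall fun a ha =>
        rn_commute (by omega) (by omega) (by omega) (by omega) (by omega) (by omega)).symm).symm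
    have h2 : Commute (descCols R n k j) (rn R n (k + j) c) :=
      descCols_commute_of_forall fun l hl => col_commute_of_forall fun a ha =>
        rn_commute (by omega) (by omega) (by omega) (by omega) (by omega) (by omega)
    have h3 := col_mul_col_mul_rn (R := R) (n := n) (m := k) (b := k + j) (c := c) (by omega)
      (by omega)
    calc col R n k (k + j) * descCols R n k j * col R n k c *
          (lowCol R n k c j * rn R n (k + j) c)
        = col R n k (k + j) * (descCols R n k j * col R n k c * lowCol R n k c j) *
            rn R n (k + j) c := by simp only [mul_assoc]
      _ = (col R n k (k + j) * lowCol R n k c j) * col R n k c *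
            (descCols R n k j * rn R n (k + j) c) := by rw [ih]; simp only [mul_assoc]
      _ = lowCol R n k c j * (col R n k (k + j) * col R n k c * rn R n (k + j) c) *
            descCols R n k j := by rw [h1.eq, h2.eq]; simp only [mul_assoc]
      _ = _ := by rw [h3]; simp only [lowCol, descCols, mul_assoc]

/-! ### The two sides on a permutation that decreases on both blocks -/

theorem app_col_of_forall {x : Perm (Fin n) →₀ R} {m c : ℕ} (h : ∀ a < m, app x (rn R n a c) = x) :
    app x (col R n m c) = x := by
  induction m with
  | zero => rfl
  | succ m ih => rw [col, app_mul, ih fun a ha => h a (by omega), h m (by omega)]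

theorem app_ascCols_of_forall {x : Perm (Fin n) →₀ R} {m : ℕ}
    (h : ∀ a c, a < c → c < m → app x (rn R n a c) = x) : app x (ascCols R n m) = x := by
  induction m with
  | zero => rfl
  | succ m ih =>
    rw [ascCols, app_mul, ih fun a c ha hc => h a c ha (by omega),
      app_col_of_forall fun a ha => h a m ha (by omega)]

theorem app_lowCol_of_forall {x : Perm (Fin n) →₀ R} {k c j : ℕ}
    (h : ∀ a, k ≤ a → a < k + j → app x (rn R n a c) = x) : app x (lowCol R n k c j) = x := by
  induction j with
  | zero => rfl
  | succ j ih =>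
    rw [lowCol, app_mul, ih fun a ha ha' => h a ha (by omega), h _ (by omega) (by omega)]

theorem app_rn_of_decOnBlocks {k : ℕ} {ζ : Perm (Fin n)} (hζ : DecOnBlocks k ζ) {a c : ℕ}
    (hac : a < c) (h : a < k ↔ c < k) : app (K R ζ) (rn R n a c) = K R ζ := by
  unfold rn
  split_ifs with hn
  · exact app_rop_of_not_cov hac fun hc => lt_asymm hc.1 (hζ _ _ hac h)
  · rfl

/-- Letters inside a block are not covers of `ζ`. Those of the first block already stand in front;
those of the second are brought there by `descCols_mul_col_mul_lowCol`, which also reverses the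
columns. -/
theorem app_ascCols_eq {k : ℕ} {ζ : Perm (Fin n)} (hζ : DecOnBlocks k ζ) (j : ℕ) :
    app (K R ζ) (ascCols R n (k + j)) = app (K R ζ) (descCols R n k j) := by
  induction j with
  | zero =>
    exact app_ascCols_of_forall fun a c hac hc => app_rn_of_decOnBlocks hζ hac (by omega)
  | succ j ih =>
    rw [← add_assoc, ascCols, app_mul, ih, ← app_mul, col_add, ← mul_assoc,
      descCols_mul_col_mul_lowCol le_rfl, app_mul,
      app_lowCol_of_forall fun a h1 h2 => app_rn_of_decOnBlocks hζ (by omega) (by omega)]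
    rfl

/-! ### Words -/

/-- Each letter is an ascent of the prefix of `g`, hence a descent after `μ`, which decreases on the
blocks. The value `d` at ascents never enters, so `d = 1` and `d = -1` are treated together. -/
theorem foldl_qop_of_decOnBlocks {k : ℕ} {μ : Perm (Fin n)} (hμ : DecOnBlocks k μ) (d : R)
    (u : List (Fin (n - 1))) (g : Perm (Fin n)) (hg : ∀ j, (g j).val < k ↔ j.val < k)
    (hu : IsReducedWord u g) :
    u.foldl (fun y i => app y (qop R 0 d i)) (K R μ) = K R (μ * g) ∧
      ∀ i ∈ u, i.val + 1 ≠ k := by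
  induction u using List.reverseRecOn generalizing g with
  | nil =>
    obtain ⟨rfl, -⟩ := hu
    exact ⟨by simp [wordProd], by simp⟩
  | append_singleton u i ih =>
    obtain ⟨h1, h2, h3, h4, h5⟩ := reducedWord_append_singleton hg hu
    obtain ⟨ih1, ih2⟩ := ih _ h4 h1
    constructor
    · have e1 := h4 (lft i)
      have e2 := h4 (rgt i)
      rw [lft_val] at e1
      rw [rgt_val, lft_val] at e2
      have : (μ * wordProd u) (rgt i) < (μ * wordProd u) (lft i) := hμ _ _ h5 (by omega)
      rw [List.foldl_append, ih1, List.foldl_cons, List.foldl_nil, app_qop_of_gt _ _ this,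
        zero_smul, add_zero, h2, mul_assoc]
    · intro j hj
      rcases List.mem_append.1 hj with hj | hj
      · exact ih2 j hj
      · rw [List.mem_singleton.1 hj]; exact h3

theorem piHatWord_app_ascCols (x : Perm (Fin n) →₀ R) (u : List (Fin (n - 1))) :
    piHatWord (app x (ascCols R n n)) u =
      app (u.foldl (fun y i => app y (qop R 0 (-1) i)) x) (ascCols R n n) := by
  induction u generalizing x with
  | nil => rfl
  | cons i u ih =>
    have := ih (app x (qop R 0 (-1) i))
    rw [List.foldl_cons, ← this, piHatWord, List.foldl_cons, piHat_eq, ← app_mul,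
      ascCols_mul_piHat (by omega), app_mul]
    rfl

theorem piWord_app_descCols {k : ℕ} (hk : k ≤ n) (x : Perm (Fin n) →₀ R) (v : List (Fin (n - 1)))
    (hv : ∀ i ∈ v, i.val + 1 ≠ k) :
    piWord (app x (descCols R n k (n - k))) v =
      app (v.foldl (fun y i => app y (qop R 0 1 i)) x) (descCols R n k (n - k)) := by
  induction v generalizing x with
  | nil => rfl
  | cons i v ih =>
    have := ih (app x (qop R 0 1 i)) fun j hj => hv j (List.mem_cons_of_mem _ hj)
    rw [List.foldl_cons, ← this, piWord, List.foldl_cons, pi_eq, ← app_mul,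
      (descCols_commute_pi (hv i List.mem_cons_self) (by omega)).eq, app_mul]
    rfl

theorem piWord_piHatWord_omega {k : ℕ} (hk : k ≤ n) {σ ζ : Perm (Fin n)} (hζ : IsMaxInCoset k σ ζ)
    {u v : List (Fin (n - 1))} (hu : IsReducedWord u (omega n * ζ))
    (hv : IsReducedWord v (ζ⁻¹ * σ)) :
    piWord (piHatWord (K R (omega n)) u) v = app (K R σ) (descCols R n k (n - k)) := by
  have hdec := decOnBlocks_of_isMaxInCoset hζ
  have hω := decOnBlocks_omega n
  have h1 : app (K R (omega n)) (ascCols R n n) = K R (omega n) :=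
    app_ascCols_of_forall fun a c hac _ => app_rn_of_decOnBlocks hω hac (by omega)
  have hωω : omega n * (omega n * ζ) = ζ := by
    rw [← mul_assoc]
    have : omega n * omega n = 1 := by ext i; simp [omega]
    rw [this, one_mul]
  have h2 := (foldl_qop_of_decOnBlocks hω (-1 : R) u _ (by simp) hu).1
  rw [hωω] at h2
  have h3 : piHatWord (K R (omega n)) u = app (K R ζ) (descCols R n k (n - k)) := by
    rw [← app_ascCols_eq hdec, Nat.add_sub_cancel' hk, ← h2, ← piHatWord_app_ascCols, h1]
  obtain ⟨g, hg, hζσ⟩ := hζ.1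
  have hg' : ∀ j, ((ζ⁻¹ * σ) j).val < k ↔ j.val < k := by
    intro j
    have e : ζ⁻¹ * σ = g⁻¹ := by rw [hζσ]; group
    rw [e, ← hg]; simp
  obtain ⟨h4, h5⟩ := foldl_qop_of_decOnBlocks hdec (1 : R) v _ hg' hv
  rw [h3, piWord_app_descCols hk _ _ h5, h4, mul_inv_cancel_left]

end Columns

/-! ### The product over all `k`-transpositions and the element `E` -/

/-- Only letters listed in opposite orders have to cross each other, so only these need to commute.
-/
theorem list_prod_eq_of_perm {M α : Type*} [Monoid M] (f : α → M) (r s : α → α → Prop)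
    (h : ∀ x y, r x y → s y x → Commute (f x) (f y)) (l l' : List α) (hp : l.Perm l')
    (hl : l.Pairwise r) (hl' : l'.Pairwise s) : (l.map f).prod = (l'.map f).prod := by
  induction l generalizing l' with
  | nil => rw [List.nil_perm.1 hp]
  | cons x t ih =>
    obtain ⟨p, q, rfl⟩ := List.append_of_mem (hp.subset List.mem_cons_self)
    have hp' : t.Perm (p ++ q) := (List.perm_cons x).1 (hp.trans List.perm_middle)
    rw [List.pairwise_cons] at hl
    have hs : ∀ y ∈ p, s y x := fun y hy =>
      (List.pairwise_append.1 hl').2.2 y hy x List.mem_cons_self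
    have hc : Commute (f x) (p.map f).prod := by
      apply Commute.list_prod_right
      intro z hz
      obtain ⟨y, hy, rfl⟩ := List.mem_map.1 hz
      exact h x y (hl.1 y (hp'.symm.subset (List.mem_append_left _ hy))) (hs y hy)
    rw [List.map_cons, List.prod_cons, ih (p ++ q) hp' hl.2
      (hl'.sublist (List.Sublist.append_left (List.sublist_cons_self x q) p))]
    simp only [List.map_append, List.map_cons, List.prod_append, List.prod_cons]
    rw [← mul_assoc, hc.eq, mul_assoc]

/-- The letters of `descCols`. -/
def descList (k : ℕ) : ℕ → List (ℕ × ℕ)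
  | 0 => []
  | d + 1 => (List.range k).map (fun a => (a, k + d)) ++ descList k d

/-- The order of the letters of `descList`. -/
def Before (p q : ℕ × ℕ) : Prop := q.2 < p.2 ∨ (p.2 = q.2 ∧ p.1 < q.1)

theorem mem_descList {k d : ℕ} {p : ℕ × ℕ} :
    p ∈ descList k d ↔ p.1 < k ∧ k ≤ p.2 ∧ p.2 < k + d := by
  induction d with
  | zero => simp only [descList, List.not_mem_nil, false_iff]; omega
  | succ d ih =>
    obtain ⟨a, b⟩ := p
    simp only [descList, List.mem_append, ih, List.mem_map, List.mem_range, Prod.mk.injEq]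
    constructor
    · rintro (⟨a', h, rfl, rfl⟩ | h) <;> simp only at * <;> omega
    · intro h
      by_cases hb : b = k + d
      · exact Or.inl ⟨a, h.1, rfl, hb.symm⟩
      · right; simp only at *; omega

theorem pairwise_descList (k d : ℕ) : (descList k d).Pairwise Before := by
  induction d with
  | zero => exact List.Pairwise.nil
  | succ d ih =>
    refine List.pairwise_append.2 ⟨?_, ih, ?_⟩
    · rw [List.pairwise_map]
      exact List.pairwise_lt_range.imp fun h => Or.inr ⟨rfl, h⟩
    · rintro x hx y hy
      obtain ⟨a, -, rfl⟩ := List.mem_map.1 hx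
      exact Or.inl (mem_descList.1 hy).2.2

section

variable {R : Type*} [CommRing R] {n : ℕ}

variable (R n) in
/-- The product of the operators of a list of transpositions. -/
noncomputable def prodOp (l : List (ℕ × ℕ)) : Op R n := (l.map fun p => rn R n p.1 p.2).prod

theorem prodOp_cons (p : ℕ × ℕ) (l : List (ℕ × ℕ)) :
    prodOp R n (p :: l) = rn R n p.1 p.2 * prodOp R n l := by
  simp [prodOp]

theorem col_eq_prodOp (m c : ℕ) :
    col R n m c = prodOp R n ((List.range m).map fun a => (a, c)) := by
  induction m with
  | zero => rfl
  | succ m ih => rw [col, ih, List.range_succ]; simp [prodOp]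

theorem descCols_eq_prodOp (k d : ℕ) : descCols R n k d = prodOp R n (descList k d) := by
  induction d with
  | zero => rfl
  | succ d ih => rw [descCols, ih, col_eq_prodOp]; simp [descList, prodOp]

/-- `Cov` with natural numbers as indices. -/
def CovN (μ : Perm (Fin n)) (p : ℕ × ℕ) : Prop :=
  ∃ (h : p.1 < n) (h' : p.2 < n), Cov μ ⟨p.1, h⟩ ⟨p.2, h'⟩

/-- Guarantees that, in the order `Before`, a letter that is not a cover at the start does not
become one after earlier letters are used. -/
theorem cov_of_cov_mul_swap {a b c d : Fin n} (hcd : c < d) (hab : a < b) (had : a < d)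
    (hcb : c < b) (h : b < d ∨ (d = b ∧ c < a)) {μ : Perm (Fin n)} (h1 : Cov μ c d)
    (h2 : Cov (μ * swap c d) a b) : Cov μ a b := by
  by_cases hdb : d = b
  · subst hdb
    have hca : c < a := by
      rcases h with h | h
      · exact absurd h (lt_irrefl _)
      · exact h.2
    obtain ⟨h2, h3⟩ := h2
    simp only [Perm.mul_apply, swap_apply_right, swap_apply_of_ne_of_ne hca.ne' hab.ne] at h2 h3
    refine ⟨h2.trans h1.1, fun r hr hr' h4 h5 => ?_⟩
    have hrc : r ≠ c := (hca.trans hr).ne'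
    rcases lt_or_gt_of_ne (μ.injective.ne hrc) with h6 | h6
    · refine h3 r hr hr' ?_ ?_ <;> rwa [swap_apply_of_ne_of_ne hrc hr'.ne]
    · exact h1.2 r (hca.trans hr) hr' h6 h5
  · have hbd : b < d := h.resolve_right fun h => hdb h.1
    by_cases hca : c = a
    · subst hca
      obtain ⟨h2, h3⟩ := h2
      simp only [Perm.mul_apply, swap_apply_left, swap_apply_of_ne_of_ne hab.ne' hbd.ne] at h2 h3
      refine ⟨h1.1.trans h2, fun r hr hr' h4 h5 => ?_⟩
      have hrd : r ≠ d := (hr'.trans hbd).ne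
      rcases lt_or_gt_of_ne (μ.injective.ne hrd) with h6 | h6
      · exact h1.2 r hr (hr'.trans hbd) h4 h6
      · refine h3 r hr hr' ?_ ?_ <;> rwa [swap_apply_of_ne_of_ne hr.ne' hrd]
    · exact (cov_swap_disjoint hcd hab hca hcb.ne had.ne' hdb μ h1 h2).1

/-- Transpositions that are not covers of the starting permutation may be left out. -/
theorem app_prodOp_filter {k : ℕ} (P : ℕ × ℕ → Bool) (l : List (ℕ × ℕ)) (hl : l.Pairwise Before)
    (hk : ∀ p ∈ l, p.1 < k ∧ k ≤ p.2) (μ : Perm (Fin n)) (hP : ∀ p ∈ l, CovN μ p → P p = true) :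
    app (K R μ) (prodOp R n l) = app (K R μ) (prodOp R n (l.filter P)) := by
  induction l generalizing μ with
  | nil => rfl
  | cons p t ih =>
    rw [List.pairwise_cons] at hl
    have hk' : ∀ q ∈ t, q.1 < k ∧ k ≤ q.2 := fun q hq => hk q (List.mem_cons_of_mem _ hq)
    have hp := hk p List.mem_cons_self
    have iht := ih hl.2 hk' μ fun q hq => hP q (List.mem_cons_of_mem _ hq)
    by_cases hc : CovN μ p
    · rw [List.filter_cons_of_pos (hP p List.mem_cons_self hc)]
      obtain ⟨h1, h2, hc⟩ := hc
      have hlt : (⟨p.1, h1⟩ : Fin n) < ⟨p.2, h2⟩ := by rw [Fin.lt_def]; simp only; omega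
      have hr : app (K R μ) (rn R n p.1 p.2) =
          K R μ - K R (μ * swap (⟨p.1, h1⟩ : Fin n) ⟨p.2, h2⟩) := by
        simp only [rn, h1, h2, and_self, dif_pos]
        exact app_rop_of_cov hlt hc
      -- A later cover of the swapped permutation was already a cover of `μ`, so the same filter `P`
      -- serves both terms.
      have ihs := ih hl.2 hk' (μ * swap (⟨p.1, h1⟩ : Fin n) ⟨p.2, h2⟩) fun q hq hcq => by
        obtain ⟨h3, h4, hq'⟩ := hcq
        have hkq := hk' q hq
        refine hP q (List.mem_cons_of_mem _ hq) ⟨h3, h4, ?_⟩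
        refine cov_of_cov_mul_swap hlt ?_ ?_ ?_ ?_ hc hq'
        · rw [Fin.lt_def]; simp only; omega
        · rw [Fin.lt_def]; simp only; omega
        · rw [Fin.lt_def]; simp only; omega
        · simpa [Fin.ext_iff, Before] using hl.1 q hq
      rw [prodOp_cons, prodOp_cons, app_mul, app_mul, hr, app_sub, app_sub, iht, ihs]
    · have hr : app (K R μ) (rn R n p.1 p.2) = K R μ := by
        unfold rn
        split_ifs with h
        · refine app_rop_of_not_cov ?_ fun h' => hc ⟨h.1, h.2, h'⟩
          rw [Fin.lt_def]; simp only; omega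
        · rfl
      rw [prodOp_cons, app_mul, hr, iht]
      by_cases hPp : P p = true
      · rw [List.filter_cons_of_pos hPp, prodOp_cons, app_mul, hr]
      · rw [List.filter_cons_of_neg hPp]

theorem mem_W {k : ℕ} {σ : Perm (Fin n)} {τ : Fin n × Fin n} : τ ∈ W k σ ↔ IsKBruhat k σ τ := by
  simp [W]

theorem pairwise_W (k : ℕ) (σ : Perm (Fin n)) : (W k σ).Pairwise (Prec σ) :=
  Finset.pairwise_sort _ _

theorem nodup_W (k : ℕ) (σ : Perm (Fin n)) : (W k σ).Nodup := Finset.sort_nodup _ _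

theorem IsKBruhat.lt {k : ℕ} {σ : Perm (Fin n)} {τ : Fin n × Fin n} (h : IsKBruhat k σ τ) :
    τ.1 < τ.2 := by
  have := h.1; have := h.2.1
  rw [Fin.lt_def]; omega

theorem IsKBruhat.cov {k : ℕ} {σ : Perm (Fin n)} {τ : Fin n × Fin n} (h : IsKBruhat k σ τ) :
    Cov σ τ.1 τ.2 := (isBruhat_iff σ h.lt).1 h.2.2

theorem rn_val (a b : Fin n) : rn R n a.val b.val = rop R a b := by
  simp [rn]

theorem foldl_actT (l : List (Fin n × Fin n)) (x : Perm (Fin n) →₀ R) :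
    l.foldl (fun x τ => x - actT R τ x) x = app x (l.map fun τ => rop R τ.1 τ.2).prod := by
  induction l generalizing x with
  | nil => rfl
  | cons τ l ih => rw [List.foldl_cons, ih, List.map_cons, List.prod_cons, app_mul]; rfl

/-- Two covers of `σ` sharing a row or a column come in the same order for `Before` and `Prec`: the
other order would put a point inside an empty rectangle. Covers ordered oppositely are therefore
disjoint and commute. -/
theorem app_descCols_eq_E {k : ℕ} (hk : k ≤ n) (σ : Perm (Fin n)) :
    app (K R σ) (descCols R n k (n - k)) = E R k σ := by
  classical
  let t : Fin n × Fin n → ℕ × ℕ := fun τ => (τ.1.val, τ.2.val)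
  have ht : Function.Injective t := by
    rintro ⟨a, b⟩ ⟨c, d⟩ h
    simpa [t, Fin.ext_iff] using h
  have hE : E R k σ = app (K R σ) (prodOp R n ((W k σ).map t)) := by
    rw [E, foldl_actT, prodOp, List.map_map]
    congr 3
    funext τ
    exact (rn_val _ _).symm
  rw [hE, descCols_eq_prodOp, app_prodOp_filter (k := k) (fun p => decide (CovN σ p)) _
    (pairwise_descList _ _) (fun p hp => ⟨(mem_descList.1 hp).1, (mem_descList.1 hp).2.1⟩) _
    (fun p _ h => by simpa using h)]
  congr 1
  set L := (descList k (n - k)).filter fun p => decide (CovN σ p) with hL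
  have hmem : ∀ p, p ∈ L ↔ p ∈ (W k σ).map t := by
    rintro ⟨a, b⟩
    simp only [hL, List.mem_filter, mem_descList, decide_eq_true_eq, List.mem_map, mem_W]
    constructor
    · rintro ⟨⟨h1, h2, h3⟩, h4, h5, h6⟩
      refine ⟨(⟨a, h4⟩, ⟨b, h5⟩), ⟨h1, h2, (isBruhat_iff σ ?_).2 h6⟩, rfl⟩
      rw [Fin.lt_def]; simp only at *; omega
    · rintro ⟨τ, h, e⟩
      have hc := h.cov
      obtain ⟨h1, h2, -⟩ := h
      obtain ⟨rfl, rfl⟩ := Prod.mk.inj e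
      exact ⟨⟨h1, h2, by have := τ.2.isLt; omega⟩, τ.1.isLt, τ.2.isLt, hc⟩
  have hnd : L.Nodup := by
    refine List.Pairwise.filter _ ((pairwise_descList k (n - k)).imp ?_)
    rintro p q h rfl
    rcases h with h | h <;> omega
  have hperm : L.Perm ((W k σ).map t) :=
    (List.perm_ext_iff_of_nodup hnd ((nodup_W k σ).map ht)).2 hmem
  let r : ℕ × ℕ → ℕ × ℕ → Prop := fun p q => Before p q
  let s : ℕ × ℕ → ℕ × ℕ → Prop := fun p q => ∃ τ θ, t τ = p ∧ t θ = q ∧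
    IsKBruhat k σ τ ∧ IsKBruhat k σ θ ∧ Prec σ τ θ
  refine list_prod_eq_of_perm _ r s ?_ L _ hperm ?_ ?_
  · rintro p q h ⟨θ, τ, rfl, rfl, hθ, hτ, hp⟩
    have cθ := hθ.cov
    have cτ := hτ.cov
    have lθ := hθ.lt
    have lτ := hτ.lt
    obtain ⟨a, b⟩ := τ
    obtain ⟨c, d⟩ := θ
    have h1 := hτ.1; have h2 := hτ.2.1; have h3 := hθ.1; have h4 := hθ.2.1
    simp only [t, r, Before, Prec] at *
    have hac : a ≠ c := by
      rintro rfl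
      have hdb : d < b := by
        rcases h with h | h
        · exact h
        · omega
      rcases hp with hp | hp
      · exact lt_irrefl _ hp
      · have : σ d < σ b := lt_of_le_of_ne hp.2 (σ.injective.ne hdb.ne)
        exact cτ.2 d lθ hdb cθ.1 this
    have hlt := hp.resolve_right fun h => hac h.1.symm
    have hbd : b ≠ d := by
      rintro rfl
      have hac' : a < c := by
        rcases h with h | h
        · omega
        · exact h.2
      exact cτ.2 c hac' lθ hlt cθ.1
    exact rn_commute lτ lθ (by omega) (by omega) (by omega) (by omega)
  · exact (pairwise_descList _ _).filter _
  · rw [List.pairwise_map]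
    refine (List.Pairwise.and_mem.1 (pairwise_W k σ)).imp ?_
    rintro τ θ ⟨h1, h2, h3⟩
    exact ⟨τ, θ, rfl, rfl, mem_W.1 h1, mem_W.1 h2, h3⟩

end

section

variable {R : Type*} [CommRing R] {n : ℕ}

/-! ### Valid subwords -/

-- Each factor `1 - τ` either skips `τ` or uses it with a sign; `sublists'` splits by the same
-- choice at the first letter.
open Classical in
theorem foldl_actT_K (l : List (Fin n × Fin n)) (μ : Perm (Fin n)) :
    l.foldl (fun x τ => x - actT R τ x) (K R μ) =
      (l.sublists'.map fun w =>
        if IsValid μ w then (-1 : R) ^ w.length • K R (endpoint μ w) else 0).sum := by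
  induction l generalizing μ with
  | nil => simp [IsValid, endpoint]
  | cons τ l ih =>
    have hact : actT R τ (K R μ) = if IsBruhat μ τ then K R (mulT μ τ) else 0 := by
      simp only [actT, K, Finsupp.linearCombination_single, one_smul]
    rw [List.foldl_cons, foldl_actT, app_sub, ← foldl_actT, ← foldl_actT, ih, hact,
      List.sublists'_cons, List.map_append, List.sum_append, List.map_map, sub_eq_add_neg]
    congr 1
    by_cases h : IsBruhat μ τ
    · rw [if_pos h, ih, ← neg_one_smul R, List.smul_sum, List.map_map]
      congr 2
      funext w
      by_cases h' : IsValid (mulT μ τ) w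
      · simp [Function.comp, IsValid, endpoint, h, h', pow_succ]
      · simp [Function.comp, IsValid, h, h']
    · rw [if_neg h, foldl_actT, app_zero, neg_zero]
      symm
      apply List.sum_eq_zero
      intro x hx
      obtain ⟨w, -, rfl⟩ := List.mem_map.1 hx
      simp [IsValid, h]

theorem mem_validSubwords {k : ℕ} {σ : Perm (Fin n)} {w : List (Fin n × Fin n)} :
    w ∈ validSubwords k σ ↔ w.Sublist (W k σ) ∧ IsValid σ w := by
  classical
  rw [validSubwords, Finset.mem_filter, List.mem_toFinset, List.mem_sublists]

theorem E_eq_sum (k : ℕ) (σ : Perm (Fin n)) :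
    E R k σ = ∑ w ∈ validSubwords k σ, (-1 : R) ^ w.length • K R (endpoint σ w) := by
  classical
  rw [E, foldl_actT_K, validSubwords, Finset.sum_filter,
    List.sum_toFinset _ (List.nodup_sublists.2 (nodup_W k σ))]
  exact ((List.sublists_perm_sublists' _).map _).sum_eq.symm

theorem isValid_append_singleton {μ : Perm (Fin n)} {w : List (Fin n × Fin n)}
    {τ : Fin n × Fin n} :
    IsValid μ (w ++ [τ]) ↔ IsValid μ w ∧ IsBruhat (endpoint μ w) τ := by
  induction w generalizing μ with
  | nil => simp [IsValid, endpoint]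
  | cons θ w ih =>
    simp only [List.cons_append, IsValid, ih, and_assoc]
    rfl

theorem endpoint_append_singleton (μ : Perm (Fin n)) (w : List (Fin n × Fin n))
    (τ : Fin n × Fin n) : endpoint μ (w ++ [τ]) = mulT (endpoint μ w) τ := by
  simp [endpoint]

theorem len_endpoint {μ : Perm (Fin n)} {w : List (Fin n × Fin n)} (h : IsValid μ w) :
    len (endpoint μ w) = len μ + w.length := by
  induction w generalizing μ with
  | nil => rfl
  | cons τ w ih =>
    have h1 := ih h.2
    have h2 := h.1
    rw [IsBruhat] at h2
    rw [List.length_cons]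
    change len (endpoint (mulT μ τ) w) = _
    omega

theorem endpoint_apply_of_forall_ne {μ : Perm (Fin n)} {w : List (Fin n × Fin n)} {a : Fin n}
    (h : ∀ τ ∈ w, a ≠ τ.1 ∧ a ≠ τ.2) : endpoint μ w a = μ a := by
  induction w using List.reverseRecOn with
  | nil => rfl
  | append_singleton w τ ih =>
    have hτ := h τ (by simp)
    rw [endpoint_append_singleton, mulT, Perm.mul_apply, swap_apply_of_ne_of_ne hτ.1 hτ.2,
      ih fun θ hθ => h θ (by simp [hθ])]

theorem le_endpoint_apply {μ : Perm (Fin n)} {w : List (Fin n × Fin n)} {a : Fin n}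
    (hv : IsValid μ w) (h : ∀ τ ∈ w, τ.1 < τ.2 ∧ a ≠ τ.2) : μ a ≤ endpoint μ w a := by
  induction w using List.reverseRecOn with
  | nil => exact le_rfl
  | append_singleton w τ ih =>
    obtain ⟨hv, hb⟩ := isValid_append_singleton.1 hv
    have ih := ih hv fun θ hθ => h θ (by simp [hθ])
    obtain ⟨hτ, ha⟩ := h τ (by simp)
    have hc := (isBruhat_iff _ hτ).1 hb
    rw [endpoint_append_singleton, mulT, Perm.mul_apply]
    by_cases ha' : a = τ.1
    · subst ha'
      rw [swap_apply_left]
      exact ih.trans hc.1.le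
    · rwa [swap_apply_of_ne_of_ne ha' ha]

/-- The obstruction that separates words with different last letters: the values at `a` and `b`
excluded here are those forced by a last letter `τ = (a, b)`. -/
theorem not_endpoint_apply_lt {k : ℕ} {σ : Perm (Fin n)} {w : List (Fin n × Fin n)}
    {τ : Fin n × Fin n} (hv : IsValid σ w) (hw : w.Pairwise (Prec σ))
    (hk : ∀ θ ∈ w, IsKBruhat k σ θ) (hτ : IsKBruhat k σ τ)
    (hp : ∀ θ ∈ w, Prec σ θ τ ∧ θ ≠ τ) (h1 : σ τ.1 ≤ endpoint σ w τ.2)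
    (h2 : endpoint σ w τ.2 < endpoint σ w τ.1) : False := by
  obtain ⟨a, b⟩ := τ
  induction w using List.reverseRecOn with
  | nil => exact absurd h2 (not_lt.2 h1)
  | append_singleton w θ ih =>
    obtain ⟨hv1, hb⟩ := isValid_append_singleton.1 hv
    obtain ⟨hw1, -, hw2⟩ := List.pairwise_append.1 hw
    have hkθ := hk θ (by simp)
    have hc := (isBruhat_iff _ hkθ.lt).1 hb
    obtain ⟨hpθ, hne⟩ := hp θ (by simp)
    obtain ⟨c, d⟩ := θ
    have hab := hτ.lt
    have hcab := hτ.cov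
    have hcd := hkθ.lt
    have hccd := hkθ.cov
    simp only at *
    by_cases hca : c = a
    · subst hca
      have hdb : d ≠ b := fun e => hne (by rw [e])
      have hσ : σ d < σ b := by
        rcases hpθ with h | h
        · exact absurd h (lt_irrefl _)
        · exact lt_of_le_of_ne h.2 (σ.injective.ne hdb)
      -- Were `d` left of `b`, its point would lie in the empty rectangle of `(c, b)`, since `σ d <
      -- σ b`.
      have hbd : b < d := by
        rcases lt_or_gt_of_ne hdb with h | h
        · exact absurd (hcab.2 d hcd h hccd.1 hσ) id
        · exact h
      rw [endpoint_append_singleton, mulT, Perm.mul_apply] at h1 h2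
      simp only [Perm.mul_apply, swap_apply_left, swap_apply_of_ne_of_ne hab.ne' hbd.ne] at h1 h2
      refine ih hv1 hw1 (fun θ hθ => hk θ (by simp [hθ])) (fun θ hθ => hp θ (by simp [hθ])) h1 ?_
      -- Position `b` lies between `c` and `d`, so its letter cannot lie between theirs; the
      -- inequality `h2` thus held before the last letter too.
      by_contra h3
      have h3 := lt_of_le_of_ne (not_lt.1 h3) ((endpoint σ w).injective.ne hab.ne)
      exact hc.2 b hab hbd h3 h2
    · have hlt : σ a < σ c := by
        rcases hpθ with h | h
        · exact h
        · exact absurd h.1 hca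
      -- Rows come in decreasing order of their `σ`-values, so a last letter in a row of larger
      -- value means that row `a` was never used.
      have : endpoint σ (w ++ [(c, d)]) a = σ a := by
        apply endpoint_apply_of_forall_ne
        intro θ hθ
        constructor
        · rintro rfl
          rcases List.mem_append.1 hθ with hθ | hθ
          · rcases hw2 θ hθ (c, d) (by simp) with h | h
            · exact lt_asymm h hlt
            · exact hca h.1.symm
          · rw [List.mem_singleton.1 hθ] at hca
            exact hca rfl
        · rintro rfl
          have e1 := hτ.1
          have e2 := (hk θ hθ).2.1
          simp only at e1
          omega
      rw [this] at h2
      exact absurd h2 (not_lt.2 h1)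

/-- After the last letter `τ = (a, b)`, position `b` holds the former letter of `a`, at least `σ a`,
and position `a` a larger one. The letters of the other word all precede `τ`, so
`not_endpoint_apply_lt` excludes this. -/
theorem not_endpoint_eq {k : ℕ} {σ : Perm (Fin n)} {w w' : List (Fin n × Fin n)}
    {τ τ' : Fin n × Fin n} (hv : IsValid σ (w ++ [τ])) (hv' : IsValid σ (w' ++ [τ']))
    (hk : ∀ θ ∈ w ++ [τ], IsKBruhat k σ θ) (hw' : (w' ++ [τ']).Pairwise (Prec σ))
    (hk' : ∀ θ ∈ w' ++ [τ'], IsKBruhat k σ θ) (hp : Prec σ τ' τ) (hne : τ' ≠ τ)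
    (h : endpoint σ (w ++ [τ]) = endpoint σ (w' ++ [τ'])) : False := by
  have hτ := hk τ (by simp)
  obtain ⟨hv1, hb⟩ := isValid_append_singleton.1 hv
  have hc := (isBruhat_iff _ hτ.lt).1 hb
  have e1 : endpoint σ (w ++ [τ]) τ.1 = endpoint σ w τ.2 := by
    rw [endpoint_append_singleton, mulT, Perm.mul_apply, swap_apply_left]
  have e2 : endpoint σ (w ++ [τ]) τ.2 = endpoint σ w τ.1 := by
    rw [endpoint_append_singleton, mulT, Perm.mul_apply, swap_apply_right]
  refine not_endpoint_apply_lt (k := k) (τ := τ) hv' hw' hk' hτ ?_ ?_ ?_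
  · intro θ hθ
    rcases List.mem_append.1 hθ with hθ | hθ
    · have h1 := (List.pairwise_append.1 hw').2.2 θ hθ τ' (by simp)
      refine ⟨_root_.trans h1 hp, ?_⟩
      rintro rfl
      exact hne (antisymm hp h1)
    · rw [List.mem_singleton.1 hθ]; exact ⟨hp, hne⟩
  · rw [← h, e2]
    refine le_endpoint_apply hv1 fun θ hθ => ?_
    have hθ := hk θ (by simp [hθ])
    refine ⟨hθ.lt, fun e => ?_⟩
    have h1 := hτ.1
    have h2 := hθ.2.1
    rw [← e] at h2
    omega
  · rw [← h, e1, e2]; exact hc.1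

theorem eq_of_endpoint_eq {k : ℕ} {σ : Perm (Fin n)} (w w' : List (Fin n × Fin n))
    (hv : IsValid σ w) (hv' : IsValid σ w') (hw : w.Pairwise (Prec σ))
    (hw' : w'.Pairwise (Prec σ)) (hk : ∀ θ ∈ w, IsKBruhat k σ θ)
    (hk' : ∀ θ ∈ w', IsKBruhat k σ θ) (h : endpoint σ w = endpoint σ w') : w = w' := by
  induction w using List.reverseRecOn generalizing w' with
  | nil =>
    have := len_endpoint hv'
    rw [← h, len_endpoint hv] at this
    exact (List.eq_nil_of_length_eq_zero (by simp only [List.length_nil] at this; omega)).symm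
  | append_singleton w τ ih =>
    induction w' using List.reverseRecOn with
    | nil =>
      have := len_endpoint hv
      rw [h, len_endpoint hv'] at this
      simp only [List.length_nil, List.length_append, List.length_singleton] at this
      omega
    | append_singleton w' τ' _ =>
      by_cases e : τ = τ'
      · subst e
        rw [endpoint_append_singleton, endpoint_append_singleton, mulT, mulT] at h
        rw [ih w' (isValid_append_singleton.1 hv).1 (isValid_append_singleton.1 hv').1
          (List.pairwise_append.1 hw).1 (List.pairwise_append.1 hw').1
          (fun θ hθ => hk θ (by simp [hθ])) (fun θ hθ => hk' θ (by simp [hθ]))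
          (mul_right_cancel h)]
      · rcases total_of (Prec σ) τ τ' with hp | hp
        · exact (not_endpoint_eq hv' hv hk' hw hk hp e h.symm).elim
        · exact (not_endpoint_eq hv hv' hk hw' hk' hp (Ne.symm e) h).elim

theorem endpoint_injOn_validSubwords {k : ℕ} {σ : Perm (Fin n)} {w w' : List (Fin n × Fin n)}
    (hw : w ∈ validSubwords k σ) (hw' : w' ∈ validSubwords k σ)
    (h : endpoint σ w = endpoint σ w') : w = w' := by
  rw [mem_validSubwords] at hw hw'
  exact eq_of_endpoint_eq (k := k) w w' hw.2 hw'.2 ((pairwise_W k σ).sublist hw.1)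
    ((pairwise_W k σ).sublist hw'.1) (fun θ hθ => mem_W.1 (hw.1.subset hθ))
    (fun θ hθ => mem_W.1 (hw'.1.subset hθ)) h

end

end ZeroHecke

theorem proposition4p2p2 (R : Type*) [CommRing R] (n k : ℕ) (hk : 1 ≤ k) (hkn : k < n)
    (σ ζ : Equiv.Perm (Fin n)) (hζ : IsMaxInCoset k σ ζ) :
    (∀ u v : List (Fin (n - 1)),
      IsReducedWord u (omega n * ζ) → IsReducedWord v (ζ⁻¹ * σ) →
        piWord (piHatWord (K R (omega n)) u) v = E R k σ) ∧
    E R k σ = ∑ w ∈ validSubwords k σ, (-1 : R) ^ w.length • K R (endpoint σ w) ∧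
    (∀ w ∈ validSubwords k σ, ∀ w' ∈ validSubwords k σ,
      endpoint σ w = endpoint σ w' → w = w') ∧
    (∀ w ∈ validSubwords k σ, len σ ≤ len (endpoint σ w) ∧
      E R k σ (endpoint σ w) = (-1 : R) ^ (len (endpoint σ w) - len σ)) ∧
    (∀ μ : Equiv.Perm (Fin n), (∀ w ∈ validSubwords k σ, endpoint σ w ≠ μ) →
      E R k σ μ = 0) := by
  have hsum := E_eq_sum (R := R) k σ
  have hcoef : ∀ μ : Equiv.Perm (Fin n), E R k σ μ =
      ∑ w ∈ validSubwords k σ, if endpoint σ w = μ then (-1 : R) ^ w.length else 0 := by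
    intro μ
    rw [hsum, Finsupp.finsetSum_apply]
    refine Finset.sum_congr rfl fun w _ => ?_
    simp [K, Finsupp.single_apply]
  refine ⟨fun u v hu hv => ?_, hsum, fun w hw w' hw' h => endpoint_injOn_validSubwords hw hw' h,
    fun w hw => ?_, fun μ hμ => ?_⟩
  · rw [piWord_piHatWord_omega hkn.le hζ hu hv, app_descCols_eq_E hkn.le]
  · have hl := len_endpoint (mem_validSubwords.1 hw).2
    refine ⟨by omega, ?_⟩
    rw [hcoef, Finset.sum_eq_single w, if_pos rfl, hl, Nat.add_sub_cancel_left]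
    · exact fun w' hw' hne => if_neg fun h => hne (endpoint_injOn_validSubwords hw' hw h)
    · exact fun h => absurd hw h
  · rw [hcoef]
    exact Finset.sum_eq_zero fun w hw => if_neg (hμ w hw)
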